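/- Let $\lambda,\mu\in\mathbb{R}$ satisfy $\mu\ge 0$ and $3\lambda+2\mu>0$ (hence $\lambda+2\mu>0$). The John (harmonic) material with Lamé coefficients $\lambda,\mu$ is the hyperelastic material with stored energy $\widehat w(\delta,\eta)=\mathcal W(\eta^{1/3},\delta/\eta)$, $\delta,\eta>0$, where \[ \mathcal W(x,y)=-2\mu x^{-3}y^{-1}+x^{-2}\Big(\tfrac12(\lambda+2\mu)y^{-2}+2(\lambda+2\mu)y^{-1}+2(\lambda+2\mu)\Big)-x^{-1}\Big((3\lambda+4\mu)y^{-1}+2(3\lambda+4\mu)\Big)+\tfrac12(9\lambda+10\mu), \] i.e. its constitutive functions on $(0,\infty)^2$ are \[ \widehat p_{\mathrm{rad}}=\delta^2\partial_\delta\widehat w,\qquad \widehat p_{\mathrm{tan}}=\widehat p_{\mathrm{rad}}+\tfrac32\,\delta\eta\,\partial_\eta\widehat w . \] For $\rho:[0,\infty)\to\mathbb{R}$ put $m(r)=4\pi\int_0^r\rho(s)s^2\,ds$. A triple $(\rho,p_{\mathrm{rad}},p_{\mathrm{tan}})$ of real functions on $[0,\infty)$ is a \emph{regular static self-gravitating ball}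 of radius $R>0$ if $\mathrm{Int}\{r>0:\rho(r)>0\}=(0,R)$ and: (i) the three functions are in $C^0([0,R])\cap C^1((0,R])$ and, for some potential $\Phi$, \[ \frac{dp_{\mathrm{rad}}}{dr}=-\frac2r(p_{\mathrm{rad}}-p_{\mathrm{tan}})-\rho\frac{d\Phi}{dr},\qquad \frac{d\Phi}{dr}=\frac{m}{r^2}\qquad\text{on }(0,R); \] (ii) $p_{\mathrm{rad}},p_{\mathrm{tan}}>0$ on $[0,R)$; (iii) $p_{\mathrm{rad}}(R)=0$; (iv) $p_{\mathrm{rad}}(0)=p_{\mathrm{tan}}(0)$; (v) $\rho=p_{\mathrm{rad}}=p_{\mathrm{tan}}=0$ on $(R,\infty)$. It is \emph{strongly regular} if moreover the three functions are in $C^1([0,R])$ and their derivatives tend to $0$ as $r\to0^+$. It is a ball of the John material with reference density $\mathcal K>0$ if $p_{\mathrm{rad}}(r)=\widehat p_{\mathrm{rad}}(\delta(r),\eta(r))$ and $p_{\mathrm{tan}}(r)=\widehat p_{\mathrm{tan}}(\delta(r),\eta(r))$ for all $r>0$ with $\rho(r)>0$, where \[ \delta(r)=\frac{\rho(r)}{\mathcal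 K},\qquad \eta(r)=\frac{m(r)}{\frac{4\pi}{3}\mathcal K r^3}. \] \textbf{Theorem.} Let $\mathcal K>0$ and let $\rho_c$ be such that $\delta_c:=\rho_c/\mathcal K>1$. Then there exists a strongly regular static self-gravitating ball of the John material with reference density $\mathcal K$ and central density $\rho(0)=\rho_c$. It is unique, even among regular static self-gravitating balls of the John material with reference density $\mathcal K$ and central density $\rho_c$. Moreover $\partial_\delta\widehat p_{\mathrm{rad}}(\delta_c,\delta_c)>0$ and, for all $r\in(0,R]$, where $R>0$ is the radius of the ball, $\rho(r)>0$ and \[ \partial_\delta\widehat p_{\mathrm{rad}}(\delta(r),\eta(r))>0,\qquad \rho(r)<\rho_c,\qquad \frac{4\pi}{3}\max(\rho(r),\mathcal K)\,r^3<m(r)<\frac{4\pi}{3}\rho_c\,r^3 . \] -/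

import Mathlib

open Topology

namespace ElasticBall

noncomputable section

/-- The mass `m(r) = 4π ∫₀ʳ ρ(s) s² ds` enclosed in the ball of radius `r`. -/
def mass (ρ : ℝ → ℝ) (r : ℝ) : ℝ :=
  4 * Real.pi * ∫ s in (0 : ℝ)..r, ρ s * s ^ 2

/-- The normalized density `δ(r) = ρ(r) / K`. -/
def normDensity (K : ℝ) (ρ : ℝ → ℝ) (r : ℝ) : ℝ :=
  ρ r / K

/-- The normalized mean density `η(r) = m(r) / ((4π/3) K r³)`. -/
def meanDensity (K : ℝ) (ρ : ℝ → ℝ) (r : ℝ) : ℝ :=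
  mass ρ r / (4 * Real.pi / 3 * K * r ^ 3)

/-- A regular static self-gravitating ball of matter of radius `R`. Profiles are functions of the
radius `r ≥ 0`; their values at negative arguments are irrelevant. -/
structure IsRegularBall (R : ℝ) (ρ prad ptan : ℝ → ℝ) : Prop where
  radius_pos : 0 < R
  /-- The interior of the matter support is `(0, R)`. -/
  support : interior {r : ℝ | 0 < r ∧ 0 < ρ r} = Set.Ioo 0 R
  continuousOn_density : ContinuousOn ρ (Set.Icc 0 R)
  continuousOn_prad : ContinuousOn prad (Set.Icc 0 R)
  continuousOn_ptan : ContinuousOn ptan (Set.Icc 0 R)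
  contDiffOn_density : ContDiffOn ℝ 1 ρ (Set.Ioc 0 R)
  contDiffOn_prad : ContDiffOn ℝ 1 prad (Set.Ioc 0 R)
  contDiffOn_ptan : ContDiffOn ℝ 1 ptan (Set.Ioc 0 R)
  /-- Hydrostatic equilibrium in the self-induced Newtonian potential `Φ`. -/
  equilibrium : ∃ Φ : ℝ → ℝ, ∀ r ∈ Set.Ioo 0 R,
    HasDerivAt Φ (mass ρ r / r ^ 2) r ∧
    HasDerivAt prad (-(2 / r) * (prad r - ptan r) - ρ r * deriv Φ r) r
  prad_pos : ∀ r ∈ Set.Ico 0 R, 0 < prad r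
  ptan_pos : ∀ r ∈ Set.Ico 0 R, 0 < ptan r
  prad_boundary : prad R = 0
  center : prad 0 = ptan 0
  vacuum : ∀ r, R < r → ρ r = 0 ∧ prad r = 0 ∧ ptan r = 0

/-- A strongly regular static self-gravitating ball of matter of radius `R`. -/
structure IsStronglyRegularBall (R : ℝ) (ρ prad ptan : ℝ → ℝ) : Prop
    extends IsRegularBall R ρ prad ptan where
  contDiffOn_density' : ContDiffOn ℝ 1 ρ (Set.Icc 0 R)
  contDiffOn_prad' : ContDiffOn ℝ 1 prad (Set.Icc 0 R)
  contDiffOn_ptan' : ContDiffOn ℝ 1 ptan (Set.Icc 0 R)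
  tendsto_deriv_density : Filter.Tendsto (deriv ρ) (𝓝[>] 0) (𝓝 0)
  tendsto_deriv_prad : Filter.Tendsto (deriv prad) (𝓝[>] 0) (𝓝 0)
  tendsto_deriv_ptan : Filter.Tendsto (deriv ptan) (𝓝[>] 0) (𝓝 0)

/-- The pressures are given by the `C¹` constitutive functions `hprad, hptan : (0,∞)² → ℝ`
evaluated at `(δ(r), η(r))`, wherever there is matter. -/
structure IsElastic (K : ℝ) (hprad hptan : ℝ → ℝ → ℝ) (ρ prad ptan : ℝ → ℝ) : Prop where
  contDiffOn_hprad :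
    ContDiffOn ℝ 1 (fun q : ℝ × ℝ => hprad q.1 q.2) (Set.Ioi 0 ×ˢ Set.Ioi 0)
  contDiffOn_hptan :
    ContDiffOn ℝ 1 (fun q : ℝ × ℝ => hptan q.1 q.2) (Set.Ioi 0 ×ˢ Set.Ioi 0)
  prad_eq : ∀ r, 0 < r → 0 < ρ r →
    prad r = hprad (normDensity K ρ r) (meanDensity K ρ r)
  ptan_eq : ∀ r, 0 < r → 0 < ρ r →
    ptan r = hptan (normDensity K ρ r) (meanDensity K ρ r)

/-- Radial constitutive function `δ² ∂_δ w` of a hyperelastic material with stored energy `w`. -/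
def hyperRad (w : ℝ → ℝ → ℝ) (δ η : ℝ) : ℝ :=
  δ ^ 2 * deriv (fun d => w d η) δ

/-- Tangential constitutive function of a hyperelastic material with stored energy `w`. -/
def hyperTan (w : ℝ → ℝ → ℝ) (δ η : ℝ) : ℝ :=
  hyperRad w δ η + 3 / 2 * δ * η * deriv (fun e => w δ e) η

/-- The John stored energy function in the variables `x = η^{1/3}`, `y = δ/η`, for Lamé
coefficients `lam, mu`. -/
def johnW (lam mu x y : ℝ) : ℝ :=
  -2 * mu * (x ^ 3)⁻¹ * y⁻¹
    + (x ^ 2)⁻¹ * (1 / 2 * (lam + 2 * mu) * (y ^ 2)⁻¹ + 2 * (lam + 2 * mu) * y⁻¹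
        + 2 * (lam + 2 * mu))
    - x⁻¹ * ((3 * lam + 4 * mu) * y⁻¹ + 2 * (3 * lam + 4 * mu))
    + 1 / 2 * (9 * lam + 10 * mu)

/-- The John stored energy function in the variables `(δ, η)`. -/
def johnEnergy (lam mu δ η : ℝ) : ℝ :=
  johnW lam mu (η ^ (1 / 3 : ℝ)) (δ / η)

/-- Radial constitutive function of the John material. -/
def johnRad (lam mu : ℝ) : ℝ → ℝ → ℝ :=
  hyperRad (johnEnergy lam mu)

/-- Tangential constitutive function of the John material. -/
def johnTan (lam mu : ℝ) : ℝ → ℝ → ℝ :=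
  hyperTan (johnEnergy lam mu)

end

end ElasticBall

/-!
The John material is harmonic: in the reference radius `s`, with deformed radius `s * u s`, the
divergence of the stress only involves the gradient of the trace `q` of the deformation gradient,
and the deformed ball of reference radius `s` has mass `(4π / 3) K s ^ 3`. Hydrostatic equilibrium
thus becomes `q' = C s / u ^ 2` with `s u' = q - 3 u`, i.e. `u'' + (4 / s) u' = C / u ^ 2`, where
the left-hand side is the radial Laplacian in dimension five. With `u 0 = α < 1` prescribed this
has a global solution, because the source is Lipschitz on `[α, ∞)` and the radial Newtonian
potential is a contraction for a weighted norm. The solution increases past `1`, where the radial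
pressure is negative, so the pressure has a first zero, which is the surface of the ball.

For uniqueness, the tangential stretch `v` and the trace `Q` of an arbitrary ball are compared, as
functions of the deformed radius `r`, with the profile evaluated at `s = r / v`: the energy
`(r - s u(s)) ^ 2 + (Q - q(s)) ^ 2` vanishes at the center and satisfies a Gronwall inequality.
-/

namespace ElasticBall

/-! ### Stretch coordinates for the John material -/

lemma rpow_third_pow {η : ℝ} (hη : 0 < η) : (η ^ (1 / 3 : ℝ)) ^ 3 = η := by
  rw [← Real.rpow_natCast, ← Real.rpow_mul hη.le]
  norm_num

lemma pow_rpow_third {x : ℝ} (hx : 0 < x) : (x ^ 3) ^ (1 / 3 : ℝ) = x := by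
  rw [← Real.rpow_natCast, ← Real.rpow_mul hx.le]
  norm_num

lemma hasDerivAt_rpow_third {η : ℝ} (hη : 0 < η) :
    HasDerivAt (fun e : ℝ => e ^ (1 / 3 : ℝ)) (1 / (3 * (η ^ (1 / 3 : ℝ)) ^ 2)) η := by
  convert Real.hasDerivAt_rpow_const (x := η) (p := 1 / 3) (Or.inl hη.ne') using 1
  rw [← Real.rpow_natCast, ← Real.rpow_mul hη.le,
    show (1 / 3 - 1 : ℝ) = -(1 / 3 * (2 : ℕ)) by norm_num, Real.rpow_neg hη.le]
  field_simp

lemma johnEnergy_eq (lam mu : ℝ) {δ η : ℝ} (hδ : 0 < δ) (hη : 0 < η) :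
    johnEnergy lam mu δ η = -2 * mu / δ
      + (lam + 2 * mu) * (1 / 2 * (η ^ (1 / 3 : ℝ)) ^ 4 / δ ^ 2 + 2 * η ^ (1 / 3 : ℝ) / δ
        + 2 / (η ^ (1 / 3 : ℝ)) ^ 2)
      - (3 * lam + 4 * mu) * ((η ^ (1 / 3 : ℝ)) ^ 2 / δ + 2 / η ^ (1 / 3 : ℝ))
      + 1 / 2 * (9 * lam + 10 * mu) := by
  have hx : 0 < η ^ (1 / 3 : ℝ) := Real.rpow_pos_of_pos hη _
  have hx3 := (rpow_third_pow hη).symm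
  unfold johnEnergy johnW
  generalize η ^ (1 / 3 : ℝ) = x at hx hx3
  subst hx3
  field_simp

lemma johnRad_eq (lam mu : ℝ) {δ η : ℝ} (hδ : 0 < δ) (hη : 0 < η) :
    johnRad lam mu δ η = 2 * mu - (lam + 2 * mu) * (η ^ (1 / 3 : ℝ)) ^ 4 / δ
      - 2 * (lam + 2 * mu) * η ^ (1 / 3 : ℝ) + (3 * lam + 4 * mu) * (η ^ (1 / 3 : ℝ)) ^ 2 := by
  set x := η ^ (1 / 3 : ℝ) with hx
  have energy_eq : (fun d => johnEnergy lam mu d η) =ᶠ[𝓝 δ] fun d => -2 * mu * d⁻¹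
      + (lam + 2 * mu) * (1 / 2 * x ^ 4 * (d⁻¹ * d⁻¹) + 2 * x * d⁻¹ + 2 / x ^ 2)
      - (3 * lam + 4 * mu) * (x ^ 2 * d⁻¹ + 2 / x) + 1 / 2 * (9 * lam + 10 * mu) := by
    filter_upwards [lt_mem_nhds hδ] with d hd
    rw [johnEnergy_eq lam mu hd hη, ← hx]
    field_simp
  have inv' := hasDerivAt_inv hδ.ne'
  have energy' := ((((inv'.const_mul (-2 * mu)).add (((((inv'.mul inv').const_mul
    (1 / 2 * x ^ 4)).add (inv'.const_mul (2 * x))).add_const (2 / x ^ 2)).const_mul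
    (lam + 2 * mu))).sub (((inv'.const_mul (x ^ 2)).add_const (2 / x)).const_mul
    (3 * lam + 4 * mu))).add_const (1 / 2 * (9 * lam + 10 * mu)))
  rw [johnRad, hyperRad, energy_eq.deriv_eq.trans energy'.deriv]
  field_simp
  ring

lemma johnTan_eq (lam mu : ℝ) {δ η : ℝ} (hδ : 0 < δ) (hη : 0 < η) :
    johnTan lam mu δ η = 2 * mu - (lam + 2 * mu) * η ^ (1 / 3 : ℝ)
      - 2 * (lam + 2 * mu) * δ / (η ^ (1 / 3 : ℝ)) ^ 2
      + (3 * lam + 4 * mu) * δ / η ^ (1 / 3 : ℝ) := by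
  have energy_eq : (fun e => johnEnergy lam mu δ e) =ᶠ[𝓝 η] fun e => -2 * mu / δ
      + (lam + 2 * mu) * (1 / 2 / δ ^ 2 * (e ^ (1 / 3 : ℝ)) ^ 4 + 2 / δ * e ^ (1 / 3 : ℝ)
        + 2 * ((e ^ (1 / 3 : ℝ))⁻¹) ^ 2)
      - (3 * lam + 4 * mu) * (1 / δ * (e ^ (1 / 3 : ℝ)) ^ 2 + 2 * (e ^ (1 / 3 : ℝ))⁻¹)
      + 1 / 2 * (9 * lam + 10 * mu) := by
    filter_upwards [lt_mem_nhds hη] with e he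
    have : 0 < e ^ (1 / 3 : ℝ) := Real.rpow_pos_of_pos he _
    rw [johnEnergy_eq lam mu hδ he]
    field_simp
  have hx : 0 < η ^ (1 / 3 : ℝ) := Real.rpow_pos_of_pos hη _
  have x' := hasDerivAt_rpow_third hη
  have inv' := x'.inv hx.ne'
  have energy' := (((((((x'.pow 4).const_mul (1 / 2 / δ ^ 2)).add (x'.const_mul (2 / δ))).add
    ((inv'.pow 2).const_mul 2)).const_mul (lam + 2 * mu)).const_add (-2 * mu / δ)).sub
    ((((x'.pow 2).const_mul (1 / δ)).add (inv'.const_mul 2)).const_mul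
      (3 * lam + 4 * mu))).add_const (1 / 2 * (9 * lam + 10 * mu))
  rw [johnTan, hyperTan, ← johnRad, johnRad_eq lam mu hδ hη,
    energy_eq.deriv_eq.trans energy'.deriv]
  simp only [Pi.inv_apply]
  have hx3 := rpow_third_pow hη
  generalize η ^ (1 / 3 : ℝ) = x at hx hx3
  subst hx3
  push_cast
  field_simp
  ring

lemma deriv_johnRad (lam mu : ℝ) {δ η : ℝ} (hδ : 0 < δ) (hη : 0 < η) :
    deriv (fun d => johnRad lam mu d η) δ
      = (lam + 2 * mu) * (η ^ (1 / 3 : ℝ)) ^ 4 / δ ^ 2 := by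
  set x := η ^ (1 / 3 : ℝ) with hx
  have rad_eq : (fun d => johnRad lam mu d η) =ᶠ[𝓝 δ] fun d =>
      2 * mu - (lam + 2 * mu) * x ^ 4 * d⁻¹ - 2 * (lam + 2 * mu) * x
        + (3 * lam + 4 * mu) * x ^ 2 := by
    filter_upwards [lt_mem_nhds hδ] with d hd
    rw [johnRad_eq lam mu hd hη, ← hx]
    ring
  have rad' := (((((hasDerivAt_inv hδ.ne').const_mul ((lam + 2 * mu) * x ^ 4)).const_sub
    (2 * mu)).sub_const (2 * (lam + 2 * mu) * x)).add_const ((3 * lam + 4 * mu) * x ^ 2))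
  rw [rad_eq.deriv_eq.trans rad'.deriv]
  field_simp

lemma deriv_johnRad_pos {lam mu δ η : ℝ} (hlam : 0 < lam + 2 * mu) (hδ : 0 < δ) (hη : 0 < η) :
    0 < deriv (fun d => johnRad lam mu d η) δ := by
  have := Real.rpow_pos_of_pos hη (1 / 3)
  rw [deriv_johnRad lam mu hδ hη]
  positivity

lemma contDiffOn_rpow_third_snd :
    ContDiffOn ℝ 1 (fun q : ℝ × ℝ => q.2 ^ (1 / 3 : ℝ)) (Set.Ioi 0 ×ˢ Set.Ioi 0) :=
  contDiffOn_snd.rpow_const_of_ne fun _ hq => (Set.mem_Ioi.1 hq.2).ne'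

lemma contDiffOn_johnRad (lam mu : ℝ) :
    ContDiffOn ℝ 1 (fun q : ℝ × ℝ => johnRad lam mu q.1 q.2) (Set.Ioi 0 ×ˢ Set.Ioi 0) := by
  have hx := contDiffOn_rpow_third_snd
  refine ContDiffOn.congr ?_ fun q hq => johnRad_eq lam mu hq.1 hq.2
  exact ((contDiffOn_const.sub ((contDiffOn_const.mul (hx.pow 4)).div contDiffOn_fst
    fun q hq => (Set.mem_Ioi.1 hq.1).ne')).sub (contDiffOn_const.mul hx)).add
    (contDiffOn_const.mul (hx.pow 2))

lemma contDiffOn_johnTan (lam mu : ℝ) :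
    ContDiffOn ℝ 1 (fun q : ℝ × ℝ => johnTan lam mu q.1 q.2) (Set.Ioi 0 ×ˢ Set.Ioi 0) := by
  have hx := contDiffOn_rpow_third_snd
  have hx0 : ∀ q ∈ (Set.Ioi (0 : ℝ) ×ˢ Set.Ioi (0 : ℝ)), q.2 ^ (1 / 3 : ℝ) ≠ 0 :=
    fun q hq => (Real.rpow_pos_of_pos hq.2 _).ne'
  refine ContDiffOn.congr ?_ fun q hq => johnTan_eq lam mu hq.1 hq.2
  exact ((contDiffOn_const.sub (contDiffOn_const.mul hx)).sub
    ((contDiffOn_const.mul contDiffOn_fst).div (hx.pow 2) fun q hq => pow_ne_zero 2 (hx0 q hq))).add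
    ((contDiffOn_const.mul contDiffOn_fst).div hx hx0)

lemma johnRad_diag_pos_iff {lam mu δ : ℝ} (hδ : 1 < δ) :
    0 < johnRad lam mu δ δ ↔ 2 * mu < (3 * lam + 4 * mu) * δ ^ (1 / 3 : ℝ) := by
  have hδ0 := one_pos.trans hδ
  have hx : 1 < δ ^ (1 / 3 : ℝ) := Real.one_lt_rpow hδ (by norm_num)
  have hx3 := (rpow_third_pow hδ0).symm
  rw [johnRad_eq lam mu hδ0 hδ0]
  generalize δ ^ (1 / 3 : ℝ) = x at hx hx3 ⊢
  have := one_pos.trans hx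
  have factored : 2 * mu - (lam + 2 * mu) * x ^ 4 / δ - 2 * (lam + 2 * mu) * x
      + (3 * lam + 4 * mu) * x ^ 2 = (x - 1) * ((3 * lam + 4 * mu) * x - 2 * mu) := by
    rw [hx3]
    field_simp
    ring
  rw [factored, mul_pos_iff_of_pos_left (sub_pos.2 hx), sub_pos]

lemma johnRad_diag_pos {lam mu δ : ℝ} (hmu : 0 ≤ mu) (hbulk : 0 < 3 * lam + 2 * mu)
    (hδ : 1 < δ) : 0 < johnRad lam mu δ δ := by
  have hx : 1 < δ ^ (1 / 3 : ℝ) := Real.one_lt_rpow hδ (by norm_num)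
  rw [johnRad_diag_pos_iff hδ]
  calc 2 * mu < 3 * lam + 4 * mu := by linarith
    _ ≤ (3 * lam + 4 * mu) * δ ^ (1 / 3 : ℝ) := le_mul_of_one_le_right (by linarith) hx.le

lemma pos_of_johnRad_diag_pos {lam mu δ : ℝ} (hmu : 0 ≤ mu) (hδ : 1 < δ)
    (hpos : 0 < johnRad lam mu δ δ) : 0 < lam + 2 * mu := by
  have hx : 0 < δ ^ (1 / 3 : ℝ) := Real.rpow_pos_of_pos (one_pos.trans hδ) _
  have := pos_of_mul_pos_left
    ((mul_nonneg zero_le_two hmu).trans_lt ((johnRad_diag_pos_iff hδ).1 hpos)) hx.le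
  linarith

/-- The normalized density `δ` of a spherically symmetric deformation with tangential stretch `a`
whose deformation gradient has trace `b`, so that the radial stretch is `b - 2 * a`. -/
noncomputable def stretchDensity (a b : ℝ) : ℝ := 1 / (a ^ 2 * (b - 2 * a))

/-- The normalized mean density `η` of a spherically symmetric deformation with tangential
stretch `a`. -/
noncomputable def stretchMeanDensity (a : ℝ) : ℝ := 1 / a ^ 3

lemma stretchDensity_pos {a b : ℝ} (ha : 0 < a) (hb : 2 * a < b) : 0 < stretchDensity a b := by
  have := sub_pos.2 hb
  unfold stretchDensity
  positivity

lemma stretchMeanDensity_pos {a : ℝ} (ha : 0 < a) : 0 < stretchMeanDensity a := by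
  unfold stretchMeanDensity
  positivity

lemma stretchDensity_three_mul (a : ℝ) : stretchDensity a (3 * a) = stretchMeanDensity a := by
  unfold stretchDensity stretchMeanDensity
  congr 1
  ring

lemma stretchMeanDensity_rpow_third {a : ℝ} (ha : 0 < a) :
    stretchMeanDensity a ^ (1 / 3 : ℝ) = 1 / a := by
  rw [stretchMeanDensity, ← one_div_pow, pow_rpow_third (by positivity)]

lemma johnRad_stretch (lam mu : ℝ) {a b : ℝ} (ha : 0 < a) (hb : 2 * a < b) :
    johnRad lam mu (stretchDensity a b) (stretchMeanDensity a)
      = (2 * mu * a ^ 2 + (3 * lam + 4 * mu) - (lam + 2 * mu) * b) / a ^ 2 := by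
  have := sub_pos.2 hb
  rw [johnRad_eq lam mu (stretchDensity_pos ha hb) (stretchMeanDensity_pos ha),
    stretchMeanDensity_rpow_third ha, stretchDensity]
  field_simp
  ring

lemma johnTan_stretch (lam mu : ℝ) {a b : ℝ} (ha : 0 < a) (hb : 2 * a < b) :
    johnTan lam mu (stretchDensity a b) (stretchMeanDensity a)
      = (2 * mu * a ^ 2 + (3 * lam + 4 * mu) - (lam + 2 * mu) * b + 2 * mu * a * (b - 3 * a))
        / (a * (b - 2 * a)) := by
  have := sub_pos.2 hb
  rw [johnTan_eq lam mu (stretchDensity_pos ha hb) (stretchMeanDensity_pos ha),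
    stretchMeanDensity_rpow_third ha, stretchDensity]
  field_simp
  ring

lemma johnRad_stretch_eq_johnTan (lam mu : ℝ) {a : ℝ} (ha : 0 < a) :
    johnRad lam mu (stretchDensity a (3 * a)) (stretchMeanDensity a)
      = johnTan lam mu (stretchDensity a (3 * a)) (stretchMeanDensity a) := by
  rw [johnRad_stretch lam mu ha (by linarith), johnTan_stretch lam mu ha (by linarith)]
  congr 1 <;> ring

lemma johnTan_stretch_pos {lam mu a b : ℝ} (hmu : 0 ≤ mu) (ha : 0 < a) (hb : 3 * a ≤ b)
    (hrad : 0 < johnRad lam mu (stretchDensity a b) (stretchMeanDensity a)) :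
    0 < johnTan lam mu (stretchDensity a b) (stretchMeanDensity a) := by
  rw [johnRad_stretch lam mu ha (by linarith), div_pos_iff_of_pos_right (by positivity)] at hrad
  rw [johnTan_stretch lam mu ha (by linarith)]
  have hshear : 0 ≤ 2 * mu * a * (b - 3 * a) := mul_nonneg (by positivity) (by linarith)
  exact div_pos (by linarith) (mul_pos ha (by linarith))

lemma johnRad_stretch_one_neg {lam mu b : ℝ} (hlam : 0 < lam + 2 * mu) (hb : 3 < b) :
    johnRad lam mu (stretchDensity 1 b) (stretchMeanDensity 1) < 0 := by
  rw [johnRad_stretch lam mu one_pos (by linarith)]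
  have := mul_pos hlam (sub_pos.2 hb)
  exact div_neg_of_neg_of_pos (by linarith) (by norm_num)

/- Only the gradient of the trace `Q` survives in the divergence of the stress: this is the
defining property of harmonic materials. -/
lemma hasDerivAt_johnRad_stretch (lam mu : ℝ) {v Q : ℝ → ℝ} {Q' r s : ℝ} (hs : 0 < s)
    (hv : 0 < v r) (hr : s * v r = r) (hQ : 2 * v r < Q r)
    (hv' : HasDerivAt v ((Q r - 3 * v r) / (s * (Q r - 2 * v r))) r) (hQ' : HasDerivAt Q Q' r) :
    HasDerivAt (fun t => johnRad lam mu (stretchDensity (v t) (Q t)) (stretchMeanDensity (v t)))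
      (-(2 / r) * (johnRad lam mu (stretchDensity (v r) (Q r)) (stretchMeanDensity (v r))
          - johnTan lam mu (stretchDensity (v r) (Q r)) (stretchMeanDensity (v r)))
        - (lam + 2 * mu) * Q' / v r ^ 2) r := by
  have hW := sub_pos.2 hQ
  have rad_eq : (fun t => johnRad lam mu (stretchDensity (v t) (Q t)) (stretchMeanDensity (v t)))
      =ᶠ[𝓝 r] fun t =>
        (2 * mu * v t ^ 2 + (3 * lam + 4 * mu) - (lam + 2 * mu) * Q t) / v t ^ 2 := by
    filter_upwards [hv'.continuousAt.eventually (lt_mem_nhds hv),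
      (hQ'.sub (hv'.const_mul 2)).continuousAt.eventually (lt_mem_nhds hW)] with t hvt hWt
    exact johnRad_stretch lam mu hvt (sub_pos.1 hWt)
  have rad' := ((((hv'.pow 2).const_mul (2 * mu)).add_const (3 * lam + 4 * mu)).sub
    (hQ'.const_mul (lam + 2 * mu))).div (hv'.pow 2) (pow_ne_zero 2 hv.ne')
  refine (rad'.congr_deriv ?_).congr_of_eventuallyEq rad_eq
  rw [johnRad_stretch lam mu hv hQ, johnTan_stretch lam mu hv hQ]
  simp only [Nat.cast_ofNat, Nat.add_one_sub_one, pow_one, Pi.sub_apply, Pi.pow_apply]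
  rw [show 2 / r = 2 / (s * v r) by rw [hr]]
  field_simp
  ring

/-! ### The radial Poisson equation -/

/-- The moment `∫₀¹ σⁿ f(sσ) dσ`, which for `s ≠ 0` is `s⁻⁽ⁿ⁺¹⁾ ∫₀ˢ tⁿ f(t) dt`; this form is
regular at `s = 0`. -/
noncomputable def powMean (n : ℕ) (f : ℝ → ℝ) (s : ℝ) : ℝ :=
  ∫ σ in (0 : ℝ)..1, σ ^ n * f (s * σ)

lemma intervalIntegrable_pow_mul_comp_mul {f : ℝ → ℝ} (hf : Continuous f) (n : ℕ) (s : ℝ) :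
    IntervalIntegrable (fun σ => σ ^ n * f (s * σ)) MeasureTheory.volume 0 1 :=
  Continuous.intervalIntegrable (by fun_prop) _ _

lemma continuous_powMean {f : ℝ → ℝ} (hf : Continuous f) (n : ℕ) : Continuous (powMean n f) := by
  apply intervalIntegral.continuous_parametric_intervalIntegral_of_continuous'
  fun_prop

lemma powMean_sub {f g : ℝ → ℝ} (hf : Continuous f) (hg : Continuous g) (n : ℕ) :
    powMean n (f - g) = powMean n f - powMean n g := by
  ext s
  simp only [powMean, Pi.sub_apply, mul_sub]
  exact intervalIntegral.integral_sub (intervalIntegrable_pow_mul_comp_mul hf n s)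
    (intervalIntegrable_pow_mul_comp_mul hg n s)

lemma powMean_nonneg {f : ℝ → ℝ} (hf : ∀ s, 0 ≤ f s) (n : ℕ) (s : ℝ) : 0 ≤ powMean n f s :=
  intervalIntegral.integral_nonneg zero_le_one fun _ hσ => mul_nonneg (pow_nonneg hσ.1 n) (hf _)

lemma abs_powMean_le_powMean {f g : ℝ → ℝ} (hf : Continuous f) (hg : Continuous g)
    (hfg : ∀ s, |f s| ≤ g s) (n : ℕ) (s : ℝ) : |powMean n f s| ≤ powMean n g s := by
  refine (intervalIntegral.abs_integral_le_integral_abs zero_le_one).trans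
    (intervalIntegral.integral_mono_on zero_le_one (intervalIntegrable_pow_mul_comp_mul hf n s).abs
      (intervalIntegrable_pow_mul_comp_mul hg n s) fun σ hσ => ?_)
  rw [abs_mul, abs_of_nonneg (pow_nonneg hσ.1 n)]
  exact mul_le_mul_of_nonneg_left (hfg _) (pow_nonneg hσ.1 n)

lemma pow_mul_powMean (n : ℕ) (f : ℝ → ℝ) (s : ℝ) :
    s ^ (n + 1) * powMean n f s = ∫ t in (0 : ℝ)..s, t ^ n * f t := by
  have rescale := intervalIntegral.smul_integral_comp_mul_left (a := 0) (b := 1)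
    (fun t => t ^ n * f t) s
  simp only [smul_eq_mul, mul_zero, mul_one] at rescale
  rw [powMean, ← rescale, pow_succ', mul_assoc, ← intervalIntegral.integral_const_mul]
  simp only [mul_pow, mul_assoc]

lemma hasDerivAt_pow_mul_powMean {f : ℝ → ℝ} (hf : Continuous f) (n : ℕ) (s : ℝ) :
    HasDerivAt (fun t => t ^ (n + 1) * powMean n f t) (s ^ n * f s) s := by
  simp only [pow_mul_powMean]
  exact (Continuous.integral_hasStrictDerivAt (by fun_prop) 0 s).hasDerivAt

lemma hasDerivAt_sq_mul_powMean {f : ℝ → ℝ} (hf : Continuous f) (n : ℕ) (s : ℝ) :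
    HasDerivAt (fun t => t ^ 2 * powMean n f t) (s * (f s - (n - 1) * powMean n f s)) s := by
  have hmean := continuous_powMean hf n
  refine hasDerivAt_of_hasDerivAt_of_ne' (x := 0)
    (g := fun s => s * (f s - (n - 1) * powMean n f s)) (fun t ht => ?_)
    (by fun_prop) (by fun_prop) s
  have quotient := (hasDerivAt_pow_mul_powMean hf n t).div
    ((hasDerivAt_pow (n + 1) t).div (hasDerivAt_pow 2 t) (pow_ne_zero 2 ht))
    (div_ne_zero (pow_ne_zero _ ht) (pow_ne_zero 2 ht))
  refine (quotient.congr_deriv ?_).congr_of_eventuallyEq ?_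
  · simp only [Pi.div_apply]
    push_cast
    field_simp
    ring
  · filter_upwards [isOpen_ne.mem_nhds ht] with x hx
    simp only [Pi.div_apply]
    field_simp [show x ≠ 0 from hx]

lemma powMean_exp_mul_sq_le {L : ℝ} (hL : 0 ≤ L) (n : ℕ) (s : ℝ) :
    powMean n (fun t => Real.exp (L * t ^ 2)) s ≤ Real.exp (L * s ^ 2) := by
  have bound := intervalIntegral.integral_mono_on zero_le_one
    (intervalIntegrable_pow_mul_comp_mul (f := fun t => Real.exp (L * t ^ 2)) (by fun_prop) n s)
    (intervalIntegrable_const (c := Real.exp (L * s ^ 2)))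
    fun σ hσ => (mul_le_of_le_one_left (Real.exp_pos _).le (pow_le_one₀ hσ.1 hσ.2)).trans
      (Real.exp_le_exp.2 (by
        rw [mul_pow]
        exact mul_le_mul_of_nonneg_left (mul_le_of_le_one_right (sq_nonneg s)
          (pow_le_one₀ hσ.1 hσ.2)) hL))
  simpa only [powMean, intervalIntegral.integral_const, sub_zero, one_smul] using bound

lemma sq_mul_powMean_exp_mul_sq {L : ℝ} (hL : L ≠ 0) (s : ℝ) :
    s ^ 2 * powMean 1 (fun t => Real.exp (L * t ^ 2)) s
      = (Real.exp (L * s ^ 2) - 1) / (2 * L) := by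
  have primitive : ∀ t ∈ Set.uIcc 0 s, HasDerivAt (fun t => Real.exp (L * t ^ 2) / (2 * L))
      (t ^ 1 * Real.exp (L * t ^ 2)) t := fun t _ => by
    refine ((((hasDerivAt_pow 2 t).const_mul L).exp).div_const (2 * L)).congr_deriv ?_
    push_cast
    field_simp
  rw [pow_mul_powMean 1, intervalIntegral.integral_eq_sub_of_hasDerivAt primitive
    (Continuous.intervalIntegrable (by fun_prop) _ _)]
  simp only [ne_eq, OfNat.ofNat_ne_zero, not_false_eq_true, zero_pow, mul_zero, Real.exp_zero]
  ring

/-- The solution `v` of `v'' + (n / s) v' = f` with `v(0) = v'(0) = 0`. For natural `n` this is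
the radial solution of Poisson's equation with source `f` in dimension `n + 1`. -/
noncomputable def radialPotential (n : ℕ) (f : ℝ → ℝ) (s : ℝ) : ℝ :=
  s ^ 2 * powMean 1 (powMean n f) s

lemma hasDerivAt_radialPotential {f : ℝ → ℝ} (hf : Continuous f) (n : ℕ) (s : ℝ) :
    HasDerivAt (radialPotential n f) (s * powMean n f s) s := by
  exact (hasDerivAt_pow_mul_powMean (continuous_powMean hf n) 1 s).congr_deriv (by rw [pow_one])

lemma continuous_radialPotential {f : ℝ → ℝ} (hf : Continuous f) (n : ℕ) :
    Continuous (radialPotential n f) :=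
  continuous_iff_continuousAt.2 fun s => (hasDerivAt_radialPotential hf n s).continuousAt

lemma radialPotential_nonneg {f : ℝ → ℝ} (hf : ∀ s, 0 ≤ f s) (n : ℕ) (s : ℝ) :
    0 ≤ radialPotential n f s :=
  mul_nonneg (sq_nonneg s) (powMean_nonneg (powMean_nonneg hf n) 1 s)

lemma radialPotential_sub {f g : ℝ → ℝ} (hf : Continuous f) (hg : Continuous g) (n : ℕ) (s : ℝ) :
    radialPotential n (f - g) s = radialPotential n f s - radialPotential n g s := by
  rw [radialPotential, powMean_sub hf hg,
    powMean_sub (continuous_powMean hf n) (continuous_powMean hg n), Pi.sub_apply, mul_sub]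
  rfl

lemma abs_radialPotential_le {f : ℝ → ℝ} {B L : ℝ} (hf : Continuous f) (hL : 0 < L)
    (hB : ∀ s, |f s| ≤ B * Real.exp (L * s ^ 2)) (n : ℕ) (s : ℝ) :
    |radialPotential n f s| ≤ B / (2 * L) * Real.exp (L * s ^ 2) := by
  have hB0 : 0 ≤ B := nonneg_of_mul_nonneg_left ((abs_nonneg _).trans (hB 0)) (Real.exp_pos _)
  have powMean_const_mul (m : ℕ) (t : ℝ) : powMean m (fun x => B * Real.exp (L * x ^ 2)) t
      = B * powMean m (fun x => Real.exp (L * x ^ 2)) t := by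
    simp only [powMean, mul_left_comm _ B, intervalIntegral.integral_const_mul]
  have mean_le : ∀ t, |powMean n f t| ≤ B * Real.exp (L * t ^ 2) := fun t =>
    calc |powMean n f t| ≤ powMean n (fun x => B * Real.exp (L * x ^ 2)) t :=
          abs_powMean_le_powMean hf (by fun_prop) hB n t
      _ = B * powMean n (fun x => Real.exp (L * x ^ 2)) t := powMean_const_mul n t
      _ ≤ B * Real.exp (L * t ^ 2) :=
          mul_le_mul_of_nonneg_left (powMean_exp_mul_sq_le hL.le n t) hB0
  calc |radialPotential n f s| = s ^ 2 * |powMean 1 (powMean n f) s| := by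
        rw [radialPotential, abs_mul, abs_of_nonneg (sq_nonneg s)]
    _ ≤ s ^ 2 * powMean 1 (fun x => B * Real.exp (L * x ^ 2)) s :=
        mul_le_mul_of_nonneg_left
          (abs_powMean_le_powMean (continuous_powMean hf n) (by fun_prop) mean_le 1 s) (sq_nonneg s)
    _ = B * (s ^ 2 * powMean 1 (fun x => Real.exp (L * x ^ 2)) s) := by
        rw [powMean_const_mul, mul_left_comm]
    _ = B / (2 * L) * (Real.exp (L * s ^ 2) - 1) := by
        rw [sq_mul_powMean_exp_mul_sq hL.ne']
        ring
    _ ≤ B / (2 * L) * Real.exp (L * s ^ 2) :=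
        mul_le_mul_of_nonneg_left (sub_le_self _ zero_le_one) (by positivity)

open BoundedContinuousFunction in
lemma exists_fixedPoint_of_weighted_contraction {X E : Type*} [TopologicalSpace X]
    [NormedAddCommGroup E] [NormedSpace ℝ E] [CompleteSpace E] {ω : X → ℝ} (hω : Continuous ω)
    (ω_pos : ∀ x, 0 < ω x) {T : (X → E) → X → E} (hT : ∀ w, Continuous w → Continuous (T w))
    {M : ℝ} (norm_T_zero : ∀ x, ‖T 0 x‖ ≤ M * ω x) {k : NNReal} (hk : k < 1)
    (contraction : ∀ w z, Continuous w → Continuous z → ∀ B : ℝ,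
      (∀ x, ‖w x - z x‖ ≤ B * ω x) → ∀ x, ‖T w x - T z x‖ ≤ k * B * ω x) :
    ∃ w, Continuous w ∧ T w = w := by
  let unweight (v : X →ᵇ E) (x : X) : E := ω x • v x
  have continuous_unweight (v) : Continuous (unweight v) := hω.smul v.continuous
  have norm_inv_smul (x : X) (e : E) : ‖(ω x)⁻¹ • e‖ = ‖e‖ / ω x := by
    rw [norm_smul, norm_inv, Real.norm_of_nonneg (ω_pos x).le, inv_mul_eq_div]
  have bounded (v : X →ᵇ E) (x : X) : ‖(ω x)⁻¹ • T (unweight v) x‖ ≤ k * ‖v‖ + M := by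
    have difference := contraction (unweight v) 0 (continuous_unweight v) continuous_zero ‖v‖
      (fun y => by
        rw [Pi.zero_apply, sub_zero, norm_smul, Real.norm_of_nonneg (ω_pos y).le, mul_comm]
        exact mul_le_mul_of_nonneg_right (v.norm_coe_le_norm y) (ω_pos y).le) x
    rw [norm_inv_smul, div_le_iff₀ (ω_pos x), add_mul]
    exact (norm_le_norm_sub_add _ _).trans (add_le_add difference (norm_T_zero x))
  let S (v : X →ᵇ E) : X →ᵇ E := ofNormedAddCommGroup (fun x => (ω x)⁻¹ • T (unweight v) x)
    ((hω.inv₀ fun x => (ω_pos x).ne').smul (hT _ (continuous_unweight v))) _ (bounded v)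
  have S_contracting : ContractingWith k S := by
    refine ⟨hk, LipschitzWith.of_dist_le_mul fun v z => (dist_le (by positivity)).2 fun x => ?_⟩
    have difference := contraction _ _ (continuous_unweight v) (continuous_unweight z) (dist v z)
      (fun y => by
        rw [← smul_sub, norm_smul, Real.norm_of_nonneg (ω_pos y).le, mul_comm, ← dist_eq_norm]
        exact mul_le_mul_of_nonneg_right (dist_coe_le_dist y) (ω_pos y).le) x
    change dist ((ω x)⁻¹ • T (unweight v) x) ((ω x)⁻¹ • T (unweight z) x) ≤ _
    rwa [dist_eq_norm, ← smul_sub, norm_inv_smul, div_le_iff₀ (ω_pos x)]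
  obtain ⟨v, hv, -⟩ := S_contracting.exists_fixedPoint 0 (edist_ne_top _ _)
  refine ⟨unweight v, continuous_unweight v, funext fun x => ?_⟩
  calc T (unweight v) x = ω x • S v x := (smul_inv_smul₀ (ω_pos x).ne' _).symm
    _ = unweight v x := by rw [hv.eq]

lemma exists_eq_add_radialPotential {f : ℝ → ℝ} {Λ : NNReal} (hf : LipschitzWith Λ f) (n : ℕ)
    (α : ℝ) : ∃ w, Continuous w ∧ ∀ s, w s = α + radialPotential n (f ∘ w) s := by
  have hL : (0 : ℝ) < Λ + 1 := by positivity
  have one_le_exp (s : ℝ) : 1 ≤ Real.exp ((Λ + 1) * s ^ 2) := Real.one_le_exp (by positivity)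
  refine (exists_fixedPoint_of_weighted_contraction (k := 1 / 2)
    (ω := fun s : ℝ => Real.exp ((Λ + 1) * s ^ 2)) (M := |α| + |f 0| / (2 * (Λ + 1)))
    (T := fun w s => α + radialPotential n (f ∘ w) s) (by fun_prop) (fun s => Real.exp_pos _)
    (fun w hw => continuous_const.add (continuous_radialPotential (hf.continuous.comp hw) n))
    (fun s => ?_) (by norm_num) (fun w z hw hz B hB s => ?_)).imp
    fun w hw => ⟨hw.1, fun s => (congrFun hw.2 s).symm⟩
  · have source_le := abs_radialPotential_le (hf.continuous.comp continuous_zero) hL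
      (fun t => le_mul_of_one_le_right (abs_nonneg (f 0)) (one_le_exp t)) n s
    rw [add_mul]
    exact (norm_add_le _ _).trans
      (add_le_add (le_mul_of_one_le_right (abs_nonneg α) (one_le_exp s)) source_le)
  · have source_le (t : ℝ) : |(f ∘ w - f ∘ z) t| ≤ Λ * B * Real.exp ((Λ + 1) * t ^ 2) := by
      rw [mul_assoc]
      exact (hf.norm_sub_le (w t) (z t)).trans (mul_le_mul_of_nonneg_left (hB t) Λ.coe_nonneg)
    have hB0 : 0 ≤ B :=
      nonneg_of_mul_nonneg_left ((norm_nonneg _).trans (hB 0)) (Real.exp_pos _)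
    rw [add_sub_add_left_eq_sub,
      ← radialPotential_sub (hf.continuous.comp hw) (hf.continuous.comp hz), Real.norm_eq_abs]
    refine (abs_radialPotential_le ((hf.continuous.comp hw).sub (hf.continuous.comp hz)) hL
      source_le n s).trans (mul_le_mul_of_nonneg_right ?_ (Real.exp_pos _).le)
    push_cast
    rw [div_le_iff₀ (by positivity)]
    linarith

/-! ### Equilibrium in the reference configuration -/

lemma contDiffOn_comp_stretch {F : ℝ → ℝ → ℝ}
    (hF : ContDiffOn ℝ 1 (fun x : ℝ × ℝ => F x.1 x.2) (Set.Ioi 0 ×ˢ Set.Ioi 0)) :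
    ContDiffOn ℝ 1 (fun x : ℝ × ℝ => F (stretchDensity x.1 x.2) (stretchMeanDensity x.1))
      {x | 0 < x.1 ∧ 2 * x.1 < x.2} := by
  refine hF.comp (.prodMk ?_ ?_) fun x hx =>
    ⟨stretchDensity_pos hx.1 hx.2, stretchMeanDensity_pos hx.1⟩
  · refine contDiffOn_const.div (by fun_prop) fun x hx => ?_
    exact (mul_pos (pow_pos hx.1 2) (sub_pos.2 hx.2)).ne'
  · exact contDiffOn_const.div (by fun_prop) fun x hx => pow_ne_zero 3 hx.1.ne'

lemma abs_inv_sq_sub_inv_sq_le {α x y : ℝ} (hα : 0 < α) (hx : α ≤ x) (hy : α ≤ y) :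
    |1 / x ^ 2 - 1 / y ^ 2| ≤ 2 / α ^ 3 * |x - y| := by
  have hx0 := hα.trans_le hx
  have hy0 := hα.trans_le hy
  have factored : 1 / x ^ 2 - 1 / y ^ 2 = -(1 / (x * y ^ 2) + 1 / (x ^ 2 * y)) * (x - y) := by
    field_simp
    ring
  rw [factored, abs_mul, abs_neg, abs_of_pos (by positivity)]
  gcongr
  calc 1 / (x * y ^ 2) + 1 / (x ^ 2 * y) ≤ 1 / (α * α ^ 2) + 1 / (α ^ 2 * α) := by gcongr
    _ = 2 / α ^ 3 := by ring

lemma lipschitzWith_div_max_sq {C α : ℝ} (hC : 0 ≤ C) (hα : 0 < α) :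
    LipschitzWith (C * (2 / α ^ 3)).toNNReal fun y => C / max y α ^ 2 :=
  LipschitzWith.of_dist_le' fun x y =>
    calc |C / max x α ^ 2 - C / max y α ^ 2| = C * |1 / max x α ^ 2 - 1 / max y α ^ 2| := by
          rw [div_eq_mul_one_div C, div_eq_mul_one_div C (max y α ^ 2), ← mul_sub, abs_mul,
            abs_of_nonneg hC]
      _ ≤ C * (2 / α ^ 3 * |max x α - max y α|) :=
          mul_le_mul_of_nonneg_left
            (abs_inv_sq_sub_inv_sq_le hα (le_max_right x α) (le_max_right y α)) hC
      _ ≤ C * (2 / α ^ 3) * |x - y| := by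
          rw [mul_assoc]
          exact mul_le_mul_of_nonneg_left
            (mul_le_mul_of_nonneg_left (abs_max_sub_max_le_abs x y α) (by positivity)) hC

/-- A self-gravitating equilibrium in the reference configuration: the sphere of radius `s` is
deformed to radius `s * u s`, the deformation gradient has trace `q s`, and the tangential stretch
at the center is `α`. Profiles are extended evenly to negative `s`. -/
structure IsLagrangianProfile (C α : ℝ) (u q : ℝ → ℝ) : Prop where
  C_pos : 0 < C
  α_pos : 0 < α
  le_u : ∀ s, α ≤ u s
  u_zero : u 0 = α
  contDiff_u : ContDiff ℝ 1 u
  hasDerivAt_q : ∀ s, HasDerivAt q (C * s / u s ^ 2) s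
  mul_deriv_u : ∀ s, s * deriv u s = q s - 3 * u s

theorem exists_isLagrangianProfile {C α : ℝ} (hC : 0 < C) (hα : 0 < α) :
    ∃ u q, IsLagrangianProfile C α u q := by
  -- Eliminating `q` leaves `u'' + (4 / s) u' = C / u ^ 2`.
  obtain ⟨u, hu, u_eq⟩ :=
    exists_eq_add_radialPotential (lipschitzWith_div_max_sq hC.le hα) 4 α
  set g : ℝ → ℝ := (fun y => C / max y α ^ 2) ∘ u with hg
  have hg_cont : Continuous g := (lipschitzWith_div_max_sq hC.le hα).continuous.comp hu
  have le_u (s : ℝ) : α ≤ u s := by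
    rw [u_eq]
    exact le_add_of_nonneg_right (radialPotential_nonneg (fun t => by
      simp only [hg, Function.comp_apply]
      positivity) 4 s)
  have g_eq (s : ℝ) : g s = C / u s ^ 2 := by rw [hg, Function.comp_apply, max_eq_left (le_u s)]
  have u' (s : ℝ) : HasDerivAt u (s * powMean 4 g s) s := by
    rw [funext u_eq]
    exact (hasDerivAt_radialPotential hg_cont 4 s).const_add α
  refine ⟨u, fun s => 3 * u s + s ^ 2 * powMean 4 g s, hC, hα, le_u, ?_, ?_, fun s => ?_,
    fun s => ?_⟩
  · rw [u_eq, radialPotential]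
    ring
  · rw [contDiff_one_iff_deriv, funext fun s => (u' s).deriv]
    exact ⟨fun s => (u' s).differentiableAt, continuous_id.mul (continuous_powMean hg_cont 4)⟩
  · refine (((u' s).const_mul 3).add (hasDerivAt_sq_mul_powMean hg_cont 4 s)).congr_deriv ?_
    rw [g_eq]
    push_cast
    ring
  · rw [(u' s).deriv]
    ring

/-- The field produced by a constitutive function `F` of `(δ, η)`, as a function of the reference
radius. -/
noncomputable def materialField (F : ℝ → ℝ → ℝ) (u q : ℝ → ℝ) (s : ℝ) : ℝ :=
  F (stretchDensity (u s) (q s)) (stretchMeanDensity (u s))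

/-- The reference radius of the sphere whose deformed radius is `r`. -/
noncomputable def refRadius (u : ℝ → ℝ) : ℝ → ℝ := Function.invFun fun s => s * u s

/-- The field produced by a constitutive function `F` of `(δ, η)`, as a function of the deformed
radius. -/
noncomputable def spatialField (F : ℝ → ℝ → ℝ) (u q : ℝ → ℝ) (r : ℝ) : ℝ :=
  materialField F u q (refRadius u r)

lemma exists_first_zero {f : ℝ → ℝ} {a b : ℝ} (hf : ContinuousOn f (Set.Icc a b)) (hab : a ≤ b)
    (ha : 0 < f a) (hb : f b < 0) :
    ∃ c ∈ Set.Ioo a b, f c = 0 ∧ ∀ x ∈ Set.Ico a c, 0 < f x := by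
  have hcompact : IsCompact (Set.Icc a b ∩ f ⁻¹' Set.Iic 0) :=
    isCompact_Icc.of_isClosed_subset (hf.preimage_isClosed_of_isClosed isClosed_Icc isClosed_Iic)
      Set.inter_subset_left
  obtain ⟨c, ⟨hc, hfc⟩, least⟩ := hcompact.exists_isLeast ⟨b, ⟨hab, le_rfl⟩, hb.le⟩
  have pos_before : ∀ x ∈ Set.Ico a c, 0 < f x := fun x hx =>
    lt_of_not_ge fun hfx => hx.2.not_ge (least ⟨⟨hx.1, hx.2.le.trans hc.2⟩, hfx⟩)
  obtain ⟨d, hd, hfd⟩ := intermediate_value_Icc' hc.1 (hf.mono (Set.Icc_subset_Icc_right hc.2))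
    ⟨hfc, ha.le⟩
  obtain rfl : d = c := hd.2.antisymm (least ⟨⟨hd.1, hd.2.trans hc.2⟩, hfd.le⟩)
  refine ⟨d, ⟨hd.1.lt_of_ne ?_, hc.2.lt_of_ne ?_⟩, hfd, pos_before⟩
  · rintro rfl
    exact ha.ne' hfd
  · rintro rfl
    exact hb.ne hfd

namespace IsLagrangianProfile

variable {C α : ℝ} {u q : ℝ → ℝ} (h : IsLagrangianProfile C α u q)

include h

lemma u_pos (s : ℝ) : 0 < u s := h.α_pos.trans_le (h.le_u s)

lemma hasDerivAt_u (s : ℝ) : HasDerivAt u (deriv u s) s :=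
  (h.contDiff_u.differentiable one_ne_zero s).hasDerivAt

lemma deriv_u_zero : deriv u 0 = 0 :=
  IsLocalMin.deriv_eq_zero (.of_forall fun s => h.u_zero.symm ▸ h.le_u s)

lemma q_zero : q 0 = 3 * α := by
  rw [← h.u_zero]
  linarith [h.mul_deriv_u 0]

lemma contDiff_q : ContDiff ℝ 1 q := by
  rw [contDiff_one_iff_deriv, funext fun s => (h.hasDerivAt_q s).deriv]
  exact ⟨fun s => (h.hasDerivAt_q s).differentiableAt, (continuous_const.mul continuous_id).div
    (h.contDiff_u.continuous.pow 2) fun s => pow_ne_zero 2 (h.u_pos s).ne'⟩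

lemma hasDerivAt_cube_mul_sub (s : ℝ) :
    HasDerivAt (fun s => s ^ 3 * (q s - 3 * u s)) (C * s ^ 4 / u s ^ 2) s := by
  refine ((hasDerivAt_pow 3 s).mul
    ((h.hasDerivAt_q s).sub ((h.hasDerivAt_u s).const_mul 3))).congr_deriv ?_
  simp only [Pi.sub_apply]
  rw [← h.mul_deriv_u s]
  push_cast
  ring

lemma strictMono_cube_mul_sub : StrictMono fun s => s ^ 3 * (q s - 3 * u s) := by
  have cont : Continuous fun s => s ^ 3 * (q s - 3 * u s) :=
    continuous_iff_continuousAt.2 fun s => (h.hasDerivAt_cube_mul_sub s).continuousAt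
  have deriv_pos {s : ℝ} (hs : s ≠ 0) : 0 < deriv (fun s => s ^ 3 * (q s - 3 * u s)) s := by
    have := h.C_pos
    have := h.u_pos s
    rw [(h.hasDerivAt_cube_mul_sub s).deriv]
    positivity
  refine StrictMonoOn.Iic_union_Ici (a := 0)
    (strictMonoOn_of_deriv_pos (convex_Iic 0) cont.continuousOn fun s hs => ?_)
    (strictMonoOn_of_deriv_pos (convex_Ici 0) cont.continuousOn fun s hs => ?_)
  · rw [interior_Iic] at hs
    exact deriv_pos hs.ne
  · rw [interior_Ici] at hs
    exact deriv_pos hs.ne'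

lemma three_mul_u_lt_q {s : ℝ} (hs : s ≠ 0) : 3 * u s < q s := by
  rcases hs.lt_or_gt with hneg | hpos
  · have decrease : s ^ 3 * (q s - 3 * u s) < 0 ^ 3 * (q 0 - 3 * u 0) :=
      h.strictMono_cube_mul_sub hneg
    have := pos_of_mul_neg_right (decrease.trans_eq (by ring))
      (Odd.pow_neg (by decide) hneg : s ^ 3 < 0).le
    linarith
  · have increase : 0 ^ 3 * (q 0 - 3 * u 0) < s ^ 3 * (q s - 3 * u s) :=
      h.strictMono_cube_mul_sub hpos
    have := pos_of_mul_pos_right (lt_of_eq_of_lt (by ring) increase) (pow_pos hpos 3).le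
    linarith

lemma three_mul_u_le_q (s : ℝ) : 3 * u s ≤ q s := by
  rcases eq_or_ne s 0 with rfl | hs
  · rw [h.u_zero, h.q_zero]
  · exact (h.three_mul_u_lt_q hs).le

lemma two_mul_u_lt_q (s : ℝ) : 2 * u s < q s := by
  linarith [h.u_pos s, h.three_mul_u_le_q s]

lemma strictMonoOn_u : StrictMonoOn u (Set.Ici 0) := by
  refine strictMonoOn_of_deriv_pos (convex_Ici 0) h.contDiff_u.continuous.continuousOn
    fun s hs => ?_
  rw [interior_Ici] at hs
  refine pos_of_mul_pos_right (a := s) ?_ hs.le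
  rw [h.mul_deriv_u]
  exact sub_pos.2 (h.three_mul_u_lt_q hs.ne')

lemma cube_mul_sub_ge {s : ℝ} (hs : 0 ≤ s) (hu : u s ≤ 1) :
    C / 5 * s ^ 5 ≤ s ^ 3 * (q s - 3 * u s) := by
  have difference' (t : ℝ) := (h.hasDerivAt_cube_mul_sub t).sub
    ((hasDerivAt_pow 5 t).const_mul (C / 5))
  have mono := monotoneOn_of_deriv_nonneg (convex_Icc 0 s)
    (fun t _ => (difference' t).continuousAt.continuousWithinAt)
    (fun t _ => (difference' t).differentiableAt.differentiableWithinAt) fun t ht => ?_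
  · have := mono ⟨le_rfl, hs⟩ ⟨hs, le_rfl⟩ hs
    simp only [Pi.sub_apply] at this
    linarith
  · rw [interior_Icc] at ht
    have hut : u t ≤ 1 := (h.strictMonoOn_u.monotoneOn ht.1.le hs ht.2.le).trans hu
    have hu2 : u t ^ 2 ≤ 1 := pow_le_one₀ (h.u_pos t).le hut
    have hsource : C * t ^ 4 ≤ C * t ^ 4 / u t ^ 2 :=
      le_div_self (mul_nonneg h.C_pos.le (by positivity)) (pow_pos (h.u_pos t) 2) hu2
    rw [(difference' t).deriv]
    push_cast
    linarith

lemma add_sq_le_u {s : ℝ} (hs : 0 ≤ s) (hu : u s ≤ 1) : α + C / 10 * s ^ 2 ≤ u s := by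
  have difference' (t : ℝ) := (h.hasDerivAt_u t).sub ((hasDerivAt_pow 2 t).const_mul (C / 10))
  have mono := monotoneOn_of_deriv_nonneg (convex_Icc 0 s)
    (fun t _ => (difference' t).continuousAt.continuousWithinAt)
    (fun t _ => (difference' t).differentiableAt.differentiableWithinAt) fun t ht => ?_
  · have := mono ⟨le_rfl, hs⟩ ⟨hs, le_rfl⟩ hs
    simp only [Pi.sub_apply, h.u_zero] at this
    linarith
  · rw [interior_Icc] at ht
    have hut : u t ≤ 1 := (h.strictMonoOn_u.monotoneOn ht.1.le hs ht.2.le).trans hu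
    have growth : t ^ 4 * (C / 5 * t) ≤ t ^ 4 * deriv u t :=
      calc t ^ 4 * (C / 5 * t) = C / 5 * t ^ 5 := by ring
        _ ≤ t ^ 3 * (q t - 3 * u t) := h.cube_mul_sub_ge ht.1.le hut
        _ = t ^ 4 * deriv u t := by
            rw [← h.mul_deriv_u]
            ring
    have := le_of_mul_le_mul_left growth (pow_pos ht.1 4)
    rw [(difference' t).deriv]
    push_cast
    linarith

lemma exists_u_eq_one (hα : α < 1) : ∃ t, 0 < t ∧ u t = 1 := by
  have hu0 : u 0 < 1 := h.u_zero.trans_lt hα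
  have huT : 1 ≤ u √(10 / C) := by
    by_contra! hlt
    have := h.add_sq_le_u (Real.sqrt_nonneg _) hlt.le
    have hC := h.C_pos
    rw [Real.sq_sqrt (by positivity), div_mul_div_cancel₀ (by norm_num),
      div_self hC.ne'] at this
    linarith [h.α_pos]
  obtain ⟨t, ht, hut⟩ := intermediate_value_Icc (Real.sqrt_nonneg _)
    h.contDiff_u.continuous.continuousOn ⟨hu0.le, huT⟩
  refine ⟨t, ht.1.lt_of_ne ?_, hut⟩
  rintro rfl
  exact hu0.ne hut

lemma hasDerivAt_radius (s : ℝ) : HasDerivAt (fun s => s * u s) (q s - 2 * u s) s := by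
  refine ((hasDerivAt_id s).mul (h.hasDerivAt_u s)).congr_deriv ?_
  rw [id, h.mul_deriv_u]
  ring

lemma strictMono_radius : StrictMono fun s => s * u s :=
  strictMono_of_deriv_pos fun s => by
    rw [(h.hasDerivAt_radius s).deriv]
    exact sub_pos.2 (h.two_mul_u_lt_q s)

lemma surjective_radius : Function.Surjective fun s => s * u s := by
  refine Continuous.surjective (continuous_id.mul h.contDiff_u.continuous) ?_ ?_
  · refine Filter.tendsto_atTop_mono' _ ?_ (Filter.tendsto_id.atTop_mul_const h.α_pos)
    filter_upwards [Filter.eventually_ge_atTop 0] with s hs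
    exact mul_le_mul_of_nonneg_left (h.le_u s) hs
  · refine Filter.tendsto_atBot_mono' _ ?_ (Filter.tendsto_id.atBot_mul_const h.α_pos)
    filter_upwards [Filter.eventually_le_atBot 0] with s hs
    exact mul_le_mul_of_nonpos_left (h.le_u s) hs

lemma refRadius_mul_u_refRadius (r : ℝ) : refRadius u r * u (refRadius u r) = r :=
  Function.rightInverse_invFun h.surjective_radius r

lemma refRadius_mul_u (s : ℝ) : refRadius u (s * u s) = s :=
  Function.leftInverse_invFun h.strictMono_radius.injective s

lemma refRadius_zero : refRadius u 0 = 0 := by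
  simpa only [zero_mul] using h.refRadius_mul_u 0

lemma strictMono_refRadius : StrictMono (refRadius u) := fun a b hab =>
  h.strictMono_radius.lt_iff_lt.1 <| by
    simpa only [h.refRadius_mul_u_refRadius] using hab

lemma continuous_refRadius : Continuous (refRadius u) :=
  h.strictMono_refRadius.monotone.continuous_of_surjective fun s => ⟨_, h.refRadius_mul_u s⟩

lemma hasDerivAt_refRadius (r : ℝ) :
    HasDerivAt (refRadius u) (q (refRadius u r) - 2 * u (refRadius u r))⁻¹ r :=
  (h.hasDerivAt_radius _).of_local_left_inverse h.continuous_refRadius.continuousAt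
    (sub_pos.2 (h.two_mul_u_lt_q _)).ne' (.of_forall h.refRadius_mul_u_refRadius)

lemma contDiff_refRadius : ContDiff ℝ 1 (refRadius u) := by
  rw [contDiff_one_iff_deriv, funext fun r => (h.hasDerivAt_refRadius r).deriv]
  have hq := h.contDiff_q.continuous
  have hu := h.contDiff_u.continuous
  exact ⟨fun r => (h.hasDerivAt_refRadius r).differentiableAt,
    ((hq.sub (continuous_const.mul hu)).comp h.continuous_refRadius).inv₀
      fun r => (sub_pos.2 (h.two_mul_u_lt_q _)).ne'⟩

section Fields

variable {F : ℝ → ℝ → ℝ}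
  (hF : ContDiffOn ℝ 1 (fun x : ℝ × ℝ => F x.1 x.2) (Set.Ioi 0 ×ˢ Set.Ioi 0))

include hF

lemma contDiff_materialField : ContDiff ℝ 1 (materialField F u q) := by
  rw [← contDiffOn_univ]
  exact (contDiffOn_comp_stretch hF).comp (h.contDiff_u.prodMk h.contDiff_q).contDiffOn
    fun s _ => ⟨h.u_pos s, h.two_mul_u_lt_q s⟩

lemma deriv_materialField_zero : deriv (materialField F u q) 0 = 0 := by
  have hopen : IsOpen {x : ℝ × ℝ | 0 < x.1 ∧ 2 * x.1 < x.2} :=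
    (isOpen_lt continuous_const continuous_fst).inter
      (isOpen_lt (continuous_const.mul continuous_fst) continuous_snd)
  have outer' := (((contDiffOn_comp_stretch hF).contDiffAt (hopen.mem_nhds
    (x := (u 0, q 0)) ⟨h.u_pos 0, h.two_mul_u_lt_q 0⟩)).differentiableAt one_ne_zero).hasFDerivAt
  have inner' : HasDerivAt (fun s => (u s, q s)) 0 0 := by
    refine ((h.hasDerivAt_u 0).prodMk (h.hasDerivAt_q 0)).congr_deriv ?_
    rw [h.deriv_u_zero, mul_zero, zero_div, Prod.mk_zero_zero]
  exact (outer'.comp_hasDerivAt 0 inner').deriv.trans (map_zero _)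

lemma contDiff_spatialField : ContDiff ℝ 1 (spatialField F u q) :=
  (h.contDiff_materialField hF).comp h.contDiff_refRadius

lemma deriv_spatialField_zero : deriv (spatialField F u q) 0 = 0 := by
  have outer' := ((h.contDiff_materialField hF).differentiable one_ne_zero
    (refRadius u 0)).hasDerivAt
  refine (outer'.comp 0 (h.hasDerivAt_refRadius 0)).deriv.trans ?_
  rw [h.refRadius_zero, h.deriv_materialField_zero hF, zero_mul]

end Fields

lemma refRadius_pos {r : ℝ} (hr : 0 < r) : 0 < refRadius u r :=
  h.refRadius_zero ▸ h.strictMono_refRadius hr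

lemma spatialField_zero (F : ℝ → ℝ → ℝ) :
    spatialField F u q 0 = F (1 / α ^ 3) (1 / α ^ 3) := by
  rw [spatialField, materialField, h.refRadius_zero, h.u_zero, h.q_zero, stretchDensity_three_mul,
    stretchMeanDensity]

lemma exists_surface {lam mu : ℝ} (hα : α < 1) (hlam : 0 < lam + 2 * mu)
    (hcenter : 0 < johnRad lam mu (1 / α ^ 3) (1 / α ^ 3)) :
    ∃ R, 0 < R ∧ u (refRadius u R) < 1 ∧ spatialField (johnRad lam mu) u q R = 0 ∧
      ∀ r ∈ Set.Ico 0 R, 0 < spatialField (johnRad lam mu) u q r := by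
  obtain ⟨t, ht, hut⟩ := h.exists_u_eq_one hα
  have htension : spatialField (johnRad lam mu) u q (t * u t) < 0 := by
    rw [spatialField, h.refRadius_mul_u, materialField, hut]
    exact johnRad_stretch_one_neg hlam (by linarith [h.three_mul_u_lt_q ht.ne'])
  rw [← h.spatialField_zero (johnRad lam mu)] at hcenter
  obtain ⟨R, hR, hzero, hpos⟩ := exists_first_zero
    (h.contDiff_spatialField (contDiffOn_johnRad lam mu)).continuous.continuousOn
    (mul_pos ht (h.u_pos t)).le hcenter htension
  have hRt : refRadius u R < t := (h.strictMono_refRadius hR.2).trans_eq (h.refRadius_mul_u t)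
  exact ⟨R, hR.1, (h.strictMonoOn_u (h.refRadius_pos hR.1).le ht.le hRt).trans_eq hut, hzero, hpos⟩

end IsLagrangianProfile

/-! ### The ball of a Lagrangian profile -/

/-- The density as a constitutive function of `(δ, η)`. -/
def densityLaw (K δ _η : ℝ) : ℝ := K * δ

lemma contDiffOn_densityLaw (K : ℝ) :
    ContDiffOn ℝ 1 (fun x : ℝ × ℝ => densityLaw K x.1 x.2) (Set.Ioi 0 ×ˢ Set.Ioi 0) :=
  contDiffOn_const.mul contDiffOn_fst

lemma normDensity_eq_iff {K r x : ℝ} {ρ : ℝ → ℝ} (hK : K ≠ 0) :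
    normDensity K ρ r = x ↔ ρ r = K * x := by
  rw [normDensity, div_eq_iff hK, mul_comm]

lemma meanDensity_eq_iff {K r x : ℝ} {ρ : ℝ → ℝ} (hK : K ≠ 0) (hr : r ≠ 0) :
    meanDensity K ρ r = x ↔ mass ρ r = 4 * Real.pi / 3 * K * x * r ^ 3 := by
  have := Real.pi_ne_zero
  rw [meanDensity, div_eq_iff (by positivity)]
  constructor <;> intro hmass <;> rw [hmass] <;> ring

lemma mass_congr {ρ ρ' : ℝ → ℝ} {r : ℝ} (hr : 0 ≤ r) (h : Set.EqOn ρ ρ' (Set.Icc 0 r)) :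
    mass ρ r = mass ρ' r := by
  unfold mass
  congr 1
  refine intervalIntegral.integral_congr fun s hs => ?_
  rw [Set.uIcc_of_le hr] at hs
  simp only [h hs]

lemma stretchDensity_lt_stretchMeanDensity {a b : ℝ} (ha : 0 < a) (hb : 3 * a < b) :
    stretchDensity a b < stretchMeanDensity a := by
  refine one_div_lt_one_div_of_lt (by positivity) ?_
  calc a ^ 3 = a ^ 2 * a := by ring
    _ < a ^ 2 * (b - 2 * a) := by
        gcongr
        linarith

lemma stretchMeanDensity_strictAnti {a b : ℝ} (ha : 0 < a) (hab : a < b) :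
    stretchMeanDensity b < stretchMeanDensity a :=
  one_div_lt_one_div_of_lt (by positivity) (by gcongr)

section Indicator

variable {f : ℝ → ℝ} {R : ℝ}

lemma indicator_Iic_eventuallyEq {r : ℝ} (hr : r < R) : (Set.Iic R).indicator f =ᶠ[𝓝 r] f :=
  (Set.eqOn_indicator (s := Set.Iic R)).eventuallyEq_of_mem (Iic_mem_nhds hr)

lemma contDiffOn_indicator_Iic (hf : ContDiff ℝ 1 f) :
    ContDiffOn ℝ 1 ((Set.Iic R).indicator f) (Set.Icc 0 R) :=
  hf.contDiffOn.congr fun _ hr => Set.indicator_of_mem (Set.mem_Iic.2 hr.2) f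

lemma tendsto_deriv_indicator_Iic (hf : ContDiff ℝ 1 f) (hf0 : deriv f 0 = 0) (hR : 0 < R) :
    Filter.Tendsto (deriv ((Set.Iic R).indicator f)) (𝓝[>] 0) (𝓝 0) := by
  have htendsto := (hf.continuous_deriv le_rfl).tendsto 0
  rw [hf0] at htendsto
  exact (htendsto.congr' (indicator_Iic_eventuallyEq hR).deriv.symm).mono_left nhdsWithin_le_nhds

end Indicator

/-- The spatial field of a Lagrangian profile, cut off outside the ball of radius `R`. -/
noncomputable def ballField (F : ℝ → ℝ → ℝ) (u q : ℝ → ℝ) (R : ℝ) : ℝ → ℝ :=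
  (Set.Iic R).indicator (spatialField F u q)

lemma ballField_of_le (F : ℝ → ℝ → ℝ) (u q : ℝ → ℝ) {r R : ℝ} (hr : r ≤ R) :
    ballField F u q R r = spatialField F u q r :=
  Set.indicator_of_mem (Set.mem_Iic.2 hr) _

lemma ballField_of_gt (F : ℝ → ℝ → ℝ) (u q : ℝ → ℝ) {r R : ℝ} (hr : R < r) :
    ballField F u q R r = 0 :=
  Set.indicator_of_notMem (Set.notMem_Iic.2 hr) _

lemma normDensity_ballField {K : ℝ} (u q : ℝ → ℝ) {r R : ℝ} (hK : K ≠ 0) (hrR : r ≤ R) :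
    normDensity K (ballField (densityLaw K) u q R) r
      = stretchDensity (u (refRadius u r)) (q (refRadius u r)) :=
  (normDensity_eq_iff hK).2 (ballField_of_le _ _ _ hrR)

namespace IsLagrangianProfile

variable {C α : ℝ} {u q : ℝ → ℝ} (h : IsLagrangianProfile C α u q)

include h

lemma hasDerivAt_tangentialStretch {r : ℝ} (hr : 0 < r) :
    HasDerivAt (fun r => u (refRadius u r))
      ((q (refRadius u r) - 3 * u (refRadius u r))
        / (refRadius u r * (q (refRadius u r) - 2 * u (refRadius u r)))) r := by
  refine ((h.hasDerivAt_u _).comp r (h.hasDerivAt_refRadius r)).congr_deriv ?_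
  rw [← h.mul_deriv_u, mul_div_mul_left _ _ (h.refRadius_pos hr).ne', div_eq_mul_inv]

lemma hasDerivAt_spatialField_johnRad (lam mu : ℝ) {r : ℝ} (hr : 0 < r) :
    HasDerivAt (spatialField (johnRad lam mu) u q)
      (-(2 / r) * (spatialField (johnRad lam mu) u q r - spatialField (johnTan lam mu) u q r)
        - (lam + 2 * mu) * (C * refRadius u r / u (refRadius u r) ^ 2
            * (q (refRadius u r) - 2 * u (refRadius u r))⁻¹) / u (refRadius u r) ^ 2) r :=
  hasDerivAt_johnRad_stretch lam mu (Q := fun r => q (refRadius u r)) (h.refRadius_pos hr)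
    (h.u_pos _) (h.refRadius_mul_u_refRadius r) (h.two_mul_u_lt_q _)
    (h.hasDerivAt_tangentialStretch hr) ((h.hasDerivAt_q _).comp r (h.hasDerivAt_refRadius r))

lemma mass_spatialField (K r : ℝ) :
    mass (spatialField (densityLaw K) u q) r = 4 * Real.pi / 3 * K * refRadius u r ^ 3 := by
  have primitive : ∀ t ∈ Set.uIcc 0 r, HasDerivAt (fun t => K / 3 * refRadius u t ^ 3)
      (spatialField (densityLaw K) u q t * t ^ 2) t := fun t _ => by
    refine (((h.hasDerivAt_refRadius t).pow 3).const_mul (K / 3)).congr_deriv ?_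
    have hradius := h.refRadius_mul_u_refRadius t
    have := h.u_pos (refRadius u t)
    have := sub_pos.2 (h.two_mul_u_lt_q (refRadius u t))
    rw [spatialField, materialField, densityLaw, stretchDensity]
    generalize refRadius u t = s at *
    subst hradius
    push_cast
    field_simp
  have integrable := ((h.contDiff_spatialField (contDiffOn_densityLaw K)).continuous.mul
    (continuous_pow 2)).intervalIntegrable (μ := MeasureTheory.volume) 0 r
  rw [mass, intervalIntegral.integral_eq_sub_of_hasDerivAt primitive integrable, h.refRadius_zero]
  ring

lemma mass_ballField (K : ℝ) {r R : ℝ} (hr : 0 ≤ r) (hrR : r ≤ R) :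
    mass (ballField (densityLaw K) u q R) r = 4 * Real.pi / 3 * K * refRadius u r ^ 3 :=
  (mass_congr hr fun _ hs => ballField_of_le _ _ _ (hs.2.trans hrR)).trans (h.mass_spatialField K r)

lemma meanDensity_ballField {K r R : ℝ} (hK : K ≠ 0) (hr : 0 < r) (hrR : r ≤ R) :
    meanDensity K (ballField (densityLaw K) u q R) r = stretchMeanDensity (u (refRadius u r)) := by
  have := h.u_pos (refRadius u r)
  have hradius : r ^ 3 = (refRadius u r * u (refRadius u r)) ^ 3 := by
    rw [h.refRadius_mul_u_refRadius]
  rw [meanDensity_eq_iff hK hr.ne', h.mass_ballField K hr.le hrR, stretchMeanDensity, hradius]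
  field_simp

lemma spatialField_densityLaw_pos {K : ℝ} (hK : 0 < K) (r : ℝ) :
    0 < spatialField (densityLaw K) u q r :=
  mul_pos hK (stretchDensity_pos (h.u_pos _) (h.two_mul_u_lt_q _))

lemma isElastic {K : ℝ} (hK : 0 < K) (lam mu R : ℝ) :
    IsElastic K (johnRad lam mu) (johnTan lam mu) (ballField (densityLaw K) u q R)
      (ballField (johnRad lam mu) u q R) (ballField (johnTan lam mu) u q R) := by
  have field_eq (F : ℝ → ℝ → ℝ) (r : ℝ) (hr : 0 < r) (hρ : 0 < ballField (densityLaw K) u q R r) :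
      ballField F u q R r = F (normDensity K (ballField (densityLaw K) u q R) r)
        (meanDensity K (ballField (densityLaw K) u q R) r) := by
    have hrR : r ≤ R := not_lt.1 fun hRr => hρ.ne' (ballField_of_gt _ _ _ hRr)
    rw [normDensity_ballField u q hK.ne' hrR, h.meanDensity_ballField hK.ne' hr hrR,
      ballField_of_le _ _ _ hrR, spatialField, materialField]
  exact ⟨contDiffOn_johnRad lam mu, contDiffOn_johnTan lam mu, field_eq _, field_eq _⟩

lemma exists_potential {lam mu K R : ℝ} (hlam : lam + 2 * mu ≠ 0)
    (hC : C = 4 * Real.pi * K ^ 2 / (3 * (lam + 2 * mu))) :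
    ∃ Φ : ℝ → ℝ, ∀ r ∈ Set.Ioo 0 R,
      HasDerivAt Φ (mass (ballField (densityLaw K) u q R) r / r ^ 2) r ∧
      HasDerivAt (ballField (johnRad lam mu) u q R)
        (-(2 / r) * (ballField (johnRad lam mu) u q R r - ballField (johnTan lam mu) u q R r)
          - ballField (densityLaw K) u q R r * deriv Φ r) r := by
  have hu (r : ℝ) : u (refRadius u r) ≠ 0 := (h.u_pos _).ne'
  have force_continuous : Continuous fun r =>
      4 * Real.pi / 3 * K * refRadius u r / u (refRadius u r) ^ 2 :=
    (continuous_const.mul h.continuous_refRadius).div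
      ((h.contDiff_u.continuous.comp h.continuous_refRadius).pow 2) fun r => pow_ne_zero 2 (hu r)
  refine ⟨fun r => ∫ t in (0 : ℝ)..r, 4 * Real.pi / 3 * K * refRadius u t / u (refRadius u t) ^ 2,
    fun r hr => ?_⟩
  have Φ' := (force_continuous.integral_hasStrictDerivAt 0 r).hasDerivAt
  have hs := (h.refRadius_pos hr.1).ne'
  refine ⟨Φ'.congr_deriv ?_, ((h.hasDerivAt_spatialField_johnRad lam mu hr.1).congr_deriv
    ?_).congr_of_eventuallyEq (indicator_Iic_eventuallyEq hr.2)⟩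
  · have hradius : r ^ 2 = (refRadius u r * u (refRadius u r)) ^ 2 := by
      rw [h.refRadius_mul_u_refRadius]
    have := hu r
    rw [h.mass_ballField K hr.1.le hr.2.le, hradius]
    field_simp
  · have := hu r
    have := (sub_pos.2 (h.two_mul_u_lt_q (refRadius u r))).ne'
    rw [Φ'.deriv, ballField_of_le _ _ _ hr.2.le, ballField_of_le _ _ _ hr.2.le,
      ballField_of_le _ _ _ hr.2.le, hC]
    congr 1
    rw [spatialField, materialField, densityLaw, stretchDensity]
    field_simp

lemma contDiffOn_ballField {F : ℝ → ℝ → ℝ} {R : ℝ}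
    (hF : ContDiffOn ℝ 1 (fun x : ℝ × ℝ => F x.1 x.2) (Set.Ioi 0 ×ˢ Set.Ioi 0)) :
    ContDiffOn ℝ 1 (ballField F u q R) (Set.Icc 0 R) :=
  contDiffOn_indicator_Iic (h.contDiff_spatialField hF)

lemma tendsto_deriv_ballField {F : ℝ → ℝ → ℝ} {R : ℝ}
    (hF : ContDiffOn ℝ 1 (fun x : ℝ × ℝ => F x.1 x.2) (Set.Ioi 0 ×ˢ Set.Ioi 0)) (hR : 0 < R) :
    Filter.Tendsto (deriv (ballField F u q R)) (𝓝[>] 0) (𝓝 0) :=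
  tendsto_deriv_indicator_Iic (h.contDiff_spatialField hF) (h.deriv_spatialField_zero hF) hR

lemma setOf_density_pos {K : ℝ} (hK : 0 < K) (R : ℝ) :
    {r | 0 < r ∧ 0 < ballField (densityLaw K) u q R r} = Set.Ioc 0 R := by
  ext r
  refine and_congr_right fun _ => ⟨fun hr => not_lt.1 fun hRr =>
    hr.ne' (ballField_of_gt _ _ _ hRr), fun hrR => ?_⟩
  rw [ballField_of_le _ _ _ hrR]
  exact h.spatialField_densityLaw_pos hK r

lemma isStronglyRegularBall {lam mu K R : ℝ} (hmu : 0 ≤ mu) (hlam : lam + 2 * mu ≠ 0)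
    (hK : 0 < K) (hC : C = 4 * Real.pi * K ^ 2 / (3 * (lam + 2 * mu))) (hR : 0 < R)
    (hpos : ∀ r ∈ Set.Ico 0 R, 0 < spatialField (johnRad lam mu) u q r)
    (hzero : spatialField (johnRad lam mu) u q R = 0) :
    IsStronglyRegularBall R (ballField (densityLaw K) u q R)
      (ballField (johnRad lam mu) u q R) (ballField (johnTan lam mu) u q R) := by
  have hρ := contDiffOn_densityLaw K
  have hrad := contDiffOn_johnRad lam mu
  have htan := contDiffOn_johnTan lam mu
  exact
    { radius_pos := hR
      support := by rw [h.setOf_density_pos hK, interior_Ioc]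
      continuousOn_density := (h.contDiffOn_ballField hρ).continuousOn
      continuousOn_prad := (h.contDiffOn_ballField hrad).continuousOn
      continuousOn_ptan := (h.contDiffOn_ballField htan).continuousOn
      contDiffOn_density := (h.contDiffOn_ballField hρ).mono Set.Ioc_subset_Icc_self
      contDiffOn_prad := (h.contDiffOn_ballField hrad).mono Set.Ioc_subset_Icc_self
      contDiffOn_ptan := (h.contDiffOn_ballField htan).mono Set.Ioc_subset_Icc_self
      equilibrium := h.exists_potential hlam hC
      prad_pos := fun r hr => by
        rw [ballField_of_le _ _ _ hr.2.le]
        exact hpos r hr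
      ptan_pos := fun r hr => by
        rw [ballField_of_le _ _ _ hr.2.le]
        exact johnTan_stretch_pos hmu (h.u_pos _) (h.three_mul_u_le_q _) (hpos r hr)
      prad_boundary := by rw [ballField_of_le _ _ _ le_rfl, hzero]
      center := by
        rw [ballField_of_le _ _ _ hR.le, ballField_of_le _ _ _ hR.le, spatialField, spatialField,
          materialField, materialField, h.refRadius_zero, h.q_zero, h.u_zero,
          johnRad_stretch_eq_johnTan lam mu h.α_pos]
      vacuum := fun r hr =>
        ⟨ballField_of_gt _ _ _ hr, ballField_of_gt _ _ _ hr, ballField_of_gt _ _ _ hr⟩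
      contDiffOn_density' := h.contDiffOn_ballField hρ
      contDiffOn_prad' := h.contDiffOn_ballField hrad
      contDiffOn_ptan' := h.contDiffOn_ballField htan
      tendsto_deriv_density := h.tendsto_deriv_ballField hρ hR
      tendsto_deriv_prad := h.tendsto_deriv_ballField hrad hR
      tendsto_deriv_ptan := h.tendsto_deriv_ballField htan hR }

lemma density_bounds {K r R : ℝ} (hK : 0 < K) (hr : 0 < r) (hrR : r ≤ R)
    (hR : u (refRadius u R) < 1) :
    ballField (densityLaw K) u q R r < K / α ^ 3 ∧
      4 * Real.pi / 3 * max (ballField (densityLaw K) u q R r) K * r ^ 3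
        < mass (ballField (densityLaw K) u q R) r ∧
      mass (ballField (densityLaw K) u q R) r < 4 * Real.pi / 3 * (K / α ^ 3) * r ^ 3 := by
  have hs := h.refRadius_pos hr
  have hu := h.u_pos (refRadius u r)
  have hu1 : u (refRadius u r) < 1 := (h.strictMonoOn_u.monotoneOn hs.le
    (h.refRadius_pos (hr.trans_le hrR)).le (h.strictMono_refRadius.monotone hrR)).trans_lt hR
  have hδη := stretchDensity_lt_stretchMeanDensity hu (h.three_mul_u_lt_q hs.ne')
  have hη1 : 1 < stretchMeanDensity (u (refRadius u r)) := by
    simpa only [stretchMeanDensity, one_pow, div_one] using stretchMeanDensity_strictAnti hu hu1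
  have hηα : stretchMeanDensity (u (refRadius u r)) < stretchMeanDensity α :=
    stretchMeanDensity_strictAnti h.α_pos
      (h.u_zero ▸ h.strictMonoOn_u Set.self_mem_Ici hs.le hs)
  have hρc : K / α ^ 3 = K * stretchMeanDensity α := div_eq_mul_one_div _ _
  have := Real.pi_pos
  rw [(meanDensity_eq_iff hK.ne' hr.ne').1 (h.meanDensity_ballField hK.ne' hr hrR),
    (normDensity_eq_iff hK.ne').1 (normDensity_ballField u q hK.ne' hrR), hρc, mul_assoc _ K]
  refine ⟨by gcongr; exact hδη.trans hηα, ?_, by gcongr⟩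
  gcongr
  exact max_lt (by gcongr) (lt_mul_of_one_lt_right hK hη1)

end IsLagrangianProfile

/-! ### Comparison of Eulerian and Lagrangian profiles -/

lemma nonpos_of_deriv_le_mul {N N' σ σ' : ℝ → ℝ} {a b l : ℝ}
    (hN : ∀ r ∈ Set.Ioo a b, HasDerivAt N (N' r) r) (hσ : ∀ r ∈ Set.Ioo a b, HasDerivAt σ (σ' r) r)
    (hle : ∀ r ∈ Set.Ioo a b, N' r ≤ σ' r * N r) (hNa : Filter.Tendsto N (𝓝[>] a) (𝓝 0))
    (hσa : Filter.Tendsto σ (𝓝[>] a) (𝓝 l)) {r : ℝ} (hr : r ∈ Set.Ioo a b) : N r ≤ 0 := by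
  have weighted' : ∀ t ∈ Set.Ioo a b, HasDerivAt (fun t => N t * Real.exp (-σ t))
      ((N' t - σ' t * N t) * Real.exp (-σ t)) t := fun t ht =>
    ((hN t ht).mul (hσ t ht).neg.exp).congr_deriv (by
      rw [Pi.neg_apply]
      ring)
  have antitone : AntitoneOn (fun t => N t * Real.exp (-σ t)) (Set.Ioo a b) := by
    refine antitoneOn_of_deriv_nonpos (convex_Ioo a b)
      (fun t ht => (weighted' t ht).continuousAt.continuousWithinAt)
      (fun t ht => ?_) fun t ht => ?_ <;> rw [interior_Ioo] at ht
    · exact (weighted' t ht).differentiableAt.differentiableWithinAt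
    · rw [(weighted' t ht).deriv]
      exact mul_nonpos_of_nonpos_of_nonneg (sub_nonpos.2 (hle t ht)) (Real.exp_pos _).le
  have limit := hNa.mul ((Real.continuous_exp.tendsto _).comp hσa.neg)
  rw [zero_mul] at limit
  refine nonpos_of_mul_nonpos_left (ge_of_tendsto limit ?_) (Real.exp_pos (-σ r))
  filter_upwards [Ioo_mem_nhdsGT hr.1] with t ht
  exact antitone ⟨ht.1, ht.2.trans hr.2⟩ hr ht.2.le

lemma energy_growth_le {C β s v w E : ℝ} (hC : 0 ≤ C) (hβ : 0 < β) (hs : 0 ≤ s) (hv : β ≤ v)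
    (hw : β ≤ w) :
    2 * (s * (v - w)) * (E - 2 * (v - w)) + 2 * E * (C * (s * (1 / v ^ 2 - 1 / w ^ 2)))
      ≤ (1 + C * (2 / β ^ 3)) * ((s * (v - w)) ^ 2 + E ^ 2) := by
  set D := s * (v - w) with hD
  have force_le : |s * (1 / v ^ 2 - 1 / w ^ 2)| ≤ 2 / β ^ 3 * |D| := by
    rw [hD, abs_mul, abs_mul, mul_left_comm]
    exact mul_le_mul_of_nonneg_left (abs_inv_sq_sub_inv_sq_le hβ hv hw) (abs_nonneg s)
  have young : 2 * (|E| * |D|) ≤ D ^ 2 + E ^ 2 := by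
    rw [← sq_abs D, ← sq_abs E]
    linarith [two_mul_le_add_sq |E| |D|]
  have dissipation : 0 ≤ D * (v - w) := by
    rw [hD, mul_assoc]
    exact mul_nonneg hs (mul_self_nonneg _)
  have coupling : 2 * (E * (s * (1 / v ^ 2 - 1 / w ^ 2))) ≤ 2 / β ^ 3 * (D ^ 2 + E ^ 2) :=
    calc 2 * (E * (s * (1 / v ^ 2 - 1 / w ^ 2)))
        ≤ 2 * (|E| * |s * (1 / v ^ 2 - 1 / w ^ 2)|) := by
          rw [← abs_mul]
          gcongr
          exact le_abs_self _
      _ ≤ 2 * (|E| * (2 / β ^ 3 * |D|)) := by gcongr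
      _ = 2 / β ^ 3 * (2 * (|E| * |D|)) := by ring
      _ ≤ 2 / β ^ 3 * (D ^ 2 + E ^ 2) := by gcongr
  linarith [mul_le_mul_of_nonneg_left coupling hC, two_mul_le_add_sq D E]

/-- A self-gravitating equilibrium in the deformed configuration on `(0, R)`: `v r` is the
tangential stretch and `Q r` the trace of the deformation gradient at the deformed radius `r`, so
that `r / v r` is the reference radius. -/
structure IsEulerianProfile (C α R : ℝ) (v Q : ℝ → ℝ) : Prop where
  exists_le_v : ∃ c > 0, ∀ r ∈ Set.Ioo 0 R, c ≤ v r
  two_mul_v_lt_Q : ∀ r ∈ Set.Ioo 0 R, 2 * v r < Q r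
  hasDerivAt_v : ∀ r ∈ Set.Ioo 0 R,
    HasDerivAt v ((Q r - 3 * v r) / (r / v r * (Q r - 2 * v r))) r
  hasDerivAt_Q : ∀ r ∈ Set.Ioo 0 R,
    HasDerivAt Q (C * (r / v r) / (v r ^ 2 * (Q r - 2 * v r))) r
  tendsto_v : Filter.Tendsto v (𝓝[>] 0) (𝓝 α)
  tendsto_Q : Filter.Tendsto Q (𝓝[>] 0) (𝓝 (3 * α))

lemma IsEulerianProfile.v_pos {C α R : ℝ} {v Q : ℝ → ℝ} (h : IsEulerianProfile C α R v Q) {r : ℝ}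
    (hr : r ∈ Set.Ioo 0 R) : 0 < v r :=
  let ⟨_, hc, hcv⟩ := h.exists_le_v
  hc.trans_le (hcv r hr)

lemma IsEulerianProfile.hasDerivAt_div {C α R : ℝ} {v Q : ℝ → ℝ} (h : IsEulerianProfile C α R v Q)
    {r : ℝ} (hr : r ∈ Set.Ioo 0 R) : HasDerivAt (fun r => r / v r) (1 / (Q r - 2 * v r)) r := by
  have := h.v_pos hr
  have := (sub_pos.2 (h.two_mul_v_lt_Q r hr)).ne'
  have := hr.1
  refine ((hasDerivAt_id r).div (h.hasDerivAt_v r hr) (h.v_pos hr).ne').congr_deriv ?_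
  rw [id, show Q r - 3 * v r = Q r - 2 * v r - v r by ring]
  generalize Q r - 2 * v r = W at *
  field_simp
  ring

lemma IsEulerianProfile.tendsto_div {C α R : ℝ} {v Q : ℝ → ℝ} (h : IsEulerianProfile C α R v Q)
    (hα : α ≠ 0) : Filter.Tendsto (fun r => r / v r) (𝓝[>] 0) (𝓝 0) := by
  have r_lim : Filter.Tendsto (fun r : ℝ => r) (𝓝[>] 0) (𝓝 0) := nhdsWithin_le_nhds
  have quotient_lim := r_lim.div h.tendsto_v hα
  rwa [zero_div] at quotient_lim

namespace IsLagrangianProfile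

variable {C α R : ℝ} {u q v Q : ℝ → ℝ} (h : IsLagrangianProfile C α u q)
  (hv : IsEulerianProfile C α R v Q)

include h hv

lemma hasDerivAt_energy {r : ℝ} (hr : r ∈ Set.Ioo 0 R) :
    HasDerivAt (fun r => (r - r / v r * u (r / v r)) ^ 2 + (Q r - q (r / v r)) ^ 2)
      ((2 * (r / v r * (v r - u (r / v r))) * (Q r - q (r / v r) - 2 * (v r - u (r / v r)))
        + 2 * (Q r - q (r / v r)) * (C * (r / v r * (1 / v r ^ 2 - 1 / u (r / v r) ^ 2))))
        / (Q r - 2 * v r)) r := by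
  have s' := hv.hasDerivAt_div hr
  have radius' := (h.hasDerivAt_radius (r / v r)).comp r s'
  have trace' := (h.hasDerivAt_q (r / v r)).comp r s'
  refine ((((hasDerivAt_id r).sub radius').pow 2).add
    (((hv.hasDerivAt_Q r hr).sub trace').pow 2)).congr_deriv ?_
  have hvr := (hv.v_pos hr).ne'
  have hW := (sub_pos.2 (hv.two_mul_v_lt_Q r hr)).ne'
  have hu := (h.u_pos (r / v r)).ne'
  simp only [Pi.sub_apply, Function.comp_apply, id]
  rw [mul_sub (r / v r), div_mul_cancel₀ r hvr]
  generalize u (r / v r) = w, q (r / v r) = p at *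
  push_cast
  field_simp
  ring

lemma tendsto_energy :
    Filter.Tendsto (fun r => (r - r / v r * u (r / v r)) ^ 2 + (Q r - q (r / v r)) ^ 2)
      (𝓝[>] 0) (𝓝 0) := by
  have r_lim : Filter.Tendsto (fun r : ℝ => r) (𝓝[>] 0) (𝓝 0) := nhdsWithin_le_nhds
  have s_lim := hv.tendsto_div h.α_pos.ne'
  have u_lim := (h.contDiff_u.continuous.tendsto 0).comp s_lim
  have q_lim := (h.contDiff_q.continuous.tendsto 0).comp s_lim
  rw [h.q_zero] at q_lim
  have energy_lim := ((r_lim.sub (s_lim.mul u_lim)).pow 2).add ((hv.tendsto_Q.sub q_lim).pow 2)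
  simpa only [zero_mul, sub_self, ne_eq, OfNat.ofNat_ne_zero, not_false_eq_true, zero_pow,
    add_zero, Function.comp_apply] using energy_lim

theorem eq_of_isEulerianProfile {r : ℝ} (hr : r ∈ Set.Ioo 0 R) :
    u (refRadius u r) = v r ∧ q (refRadius u r) = Q r := by
  obtain ⟨c, hc, hcv⟩ := hv.exists_le_v
  have energy_le : (r - r / v r * u (r / v r)) ^ 2 + (Q r - q (r / v r)) ^ 2 ≤ 0 := by
    refine nonpos_of_deriv_le_mul (fun t ht => h.hasDerivAt_energy hv ht)
      (fun t ht => (hv.hasDerivAt_div ht).const_mul (1 + C * (2 / min c α ^ 3)))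
      (fun t ht => ?_) (h.tendsto_energy hv)
      ((hv.tendsto_div h.α_pos.ne').const_mul _) hr
    have hvt := hv.v_pos ht
    have growth := energy_growth_le (E := Q t - q (t / v t)) h.C_pos.le (lt_min hc h.α_pos)
      (div_pos ht.1 hvt).le ((min_le_left c α).trans (hcv t ht))
      ((min_le_right c α).trans (h.le_u (t / v t)))
    rw [mul_one_div, div_mul_eq_mul_div (_ + _)]
    refine (div_le_div_of_nonneg_right growth (sub_pos.2 (hv.two_mul_v_lt_Q t ht)).le).trans_eq ?_
    rw [mul_sub (t / v t), div_mul_cancel₀ t hvt.ne']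
  have radius_eq : r / v r * u (r / v r) = r := by
    nlinarith [sq_nonneg (r - r / v r * u (r / v r)), sq_nonneg (Q r - q (r / v r))]
  have trace_eq : q (r / v r) = Q r := by
    nlinarith [sq_nonneg (r - r / v r * u (r / v r)), sq_nonneg (Q r - q (r / v r))]
  have hs : refRadius u r = r / v r := by
    conv_lhs => rw [← radius_eq]
    exact h.refRadius_mul_u _
  rw [hs]
  refine ⟨?_, trace_eq⟩
  have hvr := hv.v_pos hr
  refine mul_left_cancel₀ (div_pos hr.1 hvr).ne' (radius_eq.trans ?_)
  rw [div_mul_cancel₀ r hvr.ne']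

end IsLagrangianProfile

/-! ### The Eulerian profile of a regular ball -/

/-- The tangential stretch `η^(-1/3)` at mean density `η`; left inverse of `stretchMeanDensity`. -/
noncomputable def tangentialStretch (η : ℝ) : ℝ := 1 / η ^ (1 / 3 : ℝ)

/-- The trace of the deformation gradient at densities `(δ, η)`: twice the tangential stretch plus
the radial one. -/
noncomputable def stretchTrace (δ η : ℝ) : ℝ :=
  2 * tangentialStretch η + 1 / (tangentialStretch η ^ 2 * δ)

lemma tangentialStretch_pos {η : ℝ} (hη : 0 < η) : 0 < tangentialStretch η :=
  one_div_pos.2 (Real.rpow_pos_of_pos hη _)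

lemma stretchMeanDensity_tangentialStretch {η : ℝ} (hη : 0 < η) :
    stretchMeanDensity (tangentialStretch η) = η := by
  rw [stretchMeanDensity, tangentialStretch, one_div_pow, one_div_one_div, rpow_third_pow hη]

lemma tangentialStretch_stretchMeanDensity {a : ℝ} (ha : 0 < a) :
    tangentialStretch (stretchMeanDensity a) = a := by
  rw [tangentialStretch, stretchMeanDensity_rpow_third ha, one_div_one_div]

lemma stretchDensity_stretchTrace {δ η : ℝ} (hη : 0 < η) :
    stretchDensity (tangentialStretch η) (stretchTrace δ η) = δ := by
  have := tangentialStretch_pos hη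
  rw [stretchDensity, stretchTrace, add_sub_cancel_left]
  field_simp

lemma stretchTrace_stretchMeanDensity {a : ℝ} (ha : 0 < a) :
    stretchTrace (stretchMeanDensity a) (stretchMeanDensity a) = 3 * a := by
  rw [stretchTrace, tangentialStretch_stretchMeanDensity ha, stretchMeanDensity]
  field_simp
  ring

lemma two_mul_tangentialStretch_lt_stretchTrace {δ η : ℝ} (hδ : 0 < δ) (hη : 0 < η) :
    2 * tangentialStretch η < stretchTrace δ η := by
  have := tangentialStretch_pos hη
  exact lt_add_of_pos_right _ (by positivity)

lemma hasDerivAt_tangentialStretch {δ r : ℝ} {η : ℝ → ℝ} (hδ : δ ≠ 0) (hη : 0 < η r) (hr : r ≠ 0)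
    (hη' : HasDerivAt η (3 / r * (δ - η r)) r) :
    HasDerivAt (fun t => tangentialStretch (η t))
      ((stretchTrace δ (η r) - 3 * tangentialStretch (η r))
        / (r / tangentialStretch (η r)
          * (stretchTrace δ (η r) - 2 * tangentialStretch (η r)))) r := by
  have hx := Real.rpow_pos_of_pos hη (1 / 3)
  have x' := (hasDerivAt_rpow_third hη).comp r hη'
  refine ((hasDerivAt_const r (1 : ℝ)).div x' hx.ne').congr_deriv ?_
  have hx3 := (rpow_third_pow hη).symm
  simp only [Function.comp_apply, stretchTrace, tangentialStretch]
  generalize η r ^ (1 / 3 : ℝ) = x at *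
  rw [hx3]
  field_simp
  ring

section ContinuousDensity

variable {R : ℝ} {ρ : ℝ → ℝ} (hρ : ContinuousOn ρ (Set.Icc 0 R))

lemma meanDensity_eq_powMean (K : ℝ) (ρ : ℝ → ℝ) {r : ℝ} (hr : r ≠ 0) :
    meanDensity K ρ r = 3 / K * powMean 2 ρ r := by
  have hπ := Real.pi_ne_zero
  have hmass : mass ρ r = 4 * Real.pi * (r ^ 3 * powMean 2 ρ r) := by
    rw [mass, pow_mul_powMean]
    simp only [mul_comm]
  rw [meanDensity, hmass]
  field_simp

include hρ

lemma exists_continuous_eqOn_meanDensity (K : ℝ) (hR : 0 ≤ R) :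
    ∃ η, Continuous η ∧ η 0 = normDensity K ρ 0 ∧ Set.EqOn (meanDensity K ρ) η (Set.Ioc 0 R) := by
  set ρ' := Set.IccExtend hR (Set.domRestrict (Set.Icc 0 R) ρ)
  have ρ'_eq : Set.EqOn ρ ρ' (Set.Icc 0 R) := fun r hr =>
    (Set.IccExtend_of_mem hR (Set.domRestrict (Set.Icc 0 R) ρ) hr).symm
  refine ⟨fun r => 3 / K * powMean 2 ρ' r,
    continuous_const.mul (continuous_powMean hρ.domRestrict.Icc_extend' 2), ?_, fun r hr => ?_⟩
  · simp only [powMean, zero_mul, intervalIntegral.integral_mul_const, integral_pow,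
      ← ρ'_eq (Set.left_mem_Icc.2 hR), normDensity]
    norm_num
    ring
  · rw [meanDensity, mass_congr hr.1.le (ρ'_eq.mono (Set.Icc_subset_Icc_right hr.2)),
      ← meanDensity]
    exact meanDensity_eq_powMean K ρ' hr.1.ne'

lemma tendsto_meanDensity (K : ℝ) (hR : 0 < R) :
    Filter.Tendsto (meanDensity K ρ) (𝓝[>] 0) (𝓝 (normDensity K ρ 0)) := by
  obtain ⟨η, hη, hη0, η_eq⟩ := exists_continuous_eqOn_meanDensity hρ K hR.le
  rw [← hη0]
  refine ((hη.tendsto 0).mono_left nhdsWithin_le_nhds).congr' ?_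
  filter_upwards [Ioc_mem_nhdsGT hR] with r hr using (η_eq hr).symm

lemma exists_meanDensity_le (K : ℝ) (hR : 0 ≤ R) :
    ∃ B, ∀ r ∈ Set.Ioc 0 R, meanDensity K ρ r ≤ B := by
  obtain ⟨η, hη, -, η_eq⟩ := exists_continuous_eqOn_meanDensity hρ K hR
  obtain ⟨B, hB⟩ := isCompact_Icc.bddAbove_image (hη.continuousOn (s := Set.Icc 0 R))
  exact ⟨B, fun r hr => (η_eq hr).trans_le (hB ⟨r, Set.Ioc_subset_Icc_self hr, rfl⟩)⟩

lemma intervalIntegrable_mul_sq {r : ℝ} (hr : r ∈ Set.Ioc 0 R) :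
    IntervalIntegrable (fun s => ρ s * s ^ 2) MeasureTheory.volume 0 r :=
  ContinuousOn.intervalIntegrable_of_Icc hr.1.le
    ((hρ.mono (Set.Icc_subset_Icc_right hr.2)).mul (continuousOn_pow 2))

lemma mass_pos {r : ℝ} (hr : r ∈ Set.Ioc 0 R) (hpos : ∀ s ∈ Set.Ioo 0 r, 0 < ρ s) :
    0 < mass ρ r :=
  mul_pos (by positivity) (intervalIntegral.intervalIntegral_pos_of_pos_on
    (intervalIntegrable_mul_sq hρ hr) (fun s hs => mul_pos (hpos s hs) (pow_pos hs.1 2)) hr.1)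

lemma hasDerivAt_mass {r : ℝ} (hr : r ∈ Set.Ioo 0 R) :
    HasDerivAt (mass ρ) (4 * Real.pi * (ρ r * r ^ 2)) r := by
  have cont : ContinuousOn (fun s => ρ s * s ^ 2) (Set.Ioo 0 R) :=
    (hρ.mono Set.Ioo_subset_Icc_self).mul (continuousOn_pow 2)
  exact (intervalIntegral.integral_hasDerivAt_right
    (intervalIntegrable_mul_sq hρ ⟨hr.1, hr.2.le⟩)
    (cont.stronglyMeasurableAtFilter isOpen_Ioo r hr)
    (cont.continuousAt (isOpen_Ioo.mem_nhds hr))).const_mul _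

lemma hasDerivAt_meanDensity {K : ℝ} (hK : K ≠ 0) {r : ℝ} (hr : r ∈ Set.Ioo 0 R) :
    HasDerivAt (meanDensity K ρ) (3 / r * (normDensity K ρ r - meanDensity K ρ r)) r := by
  have := Real.pi_ne_zero
  have := hr.1
  refine ((hasDerivAt_mass hρ hr).div ((hasDerivAt_pow 3 r).const_mul (4 * Real.pi / 3 * K))
    (by positivity)).congr_deriv ?_
  rw [normDensity, meanDensity]
  push_cast
  field_simp

end ContinuousDensity

namespace IsRegularBall

variable {R : ℝ} {ρ prad ptan : ℝ → ℝ} (hB : IsRegularBall R ρ prad ptan)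

include hB

lemma density_pos {r : ℝ} (hr : r ∈ Set.Ioo 0 R) : 0 < ρ r :=
  (interior_subset (hB.support.symm ▸ hr)).2

lemma meanDensity_pos {K r : ℝ} (hK : 0 < K) (hr : r ∈ Set.Ioo 0 R) : 0 < meanDensity K ρ r := by
  have := hr.1
  exact div_pos (mass_pos hB.continuousOn_density ⟨hr.1, hr.2.le⟩ fun s hs =>
    hB.density_pos ⟨hs.1, hs.2.trans hr.2⟩) (by positivity)

lemma tendsto_normDensity (K : ℝ) :
    Filter.Tendsto (normDensity K ρ) (𝓝[>] 0) (𝓝 (normDensity K ρ 0)) := by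
  rw [← nhdsWithin_Ioo_eq_nhdsGT hB.radius_pos]
  exact ((hB.continuousOn_density 0 ⟨le_rfl, hB.radius_pos.le⟩).mono_left
    (nhdsWithin_mono _ Set.Ioo_subset_Icc_self)).div_const K

lemma eqOn_ballField {F : ℝ → ℝ → ℝ} {f u q : ℝ → ℝ} (hf : ContinuousOn f (Set.Icc 0 R))
    (hF : Continuous (spatialField F u q)) (heq : Set.EqOn f (spatialField F u q) (Set.Ioo 0 R))
    (hvacuum : ∀ r, R < r → f r = 0) : Set.EqOn f (ballField F u q R) (Set.Ici 0) := by
  have heq_closed : Set.EqOn f (spatialField F u q) (Set.Icc 0 R) :=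
    heq.of_subset_closure hf hF.continuousOn Set.Ioo_subset_Icc_self
      (closure_Ioo hB.radius_pos.ne).symm.subset
  intro r hr
  rcases le_or_gt r R with hrR | hrR
  · rw [ballField_of_le _ _ _ hrR, heq_closed ⟨hr, hrR⟩]
  · rw [ballField_of_gt _ _ _ hrR, hvacuum r hrR]

lemma hasDerivAt_tangentialStretch {K r : ℝ} (hK : 0 < K) (hr : r ∈ Set.Ioo 0 R) :
    HasDerivAt (fun t => tangentialStretch (meanDensity K ρ t))
      ((stretchTrace (normDensity K ρ r) (meanDensity K ρ r)
          - 3 * tangentialStretch (meanDensity K ρ r))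
        / (r / tangentialStretch (meanDensity K ρ r)
          * (stretchTrace (normDensity K ρ r) (meanDensity K ρ r)
            - 2 * tangentialStretch (meanDensity K ρ r)))) r :=
  ElasticBall.hasDerivAt_tangentialStretch (div_pos (hB.density_pos hr) hK).ne'
    (hB.meanDensity_pos hK hr) hr.1.ne'
    (hasDerivAt_meanDensity hB.continuousOn_density hK.ne' hr)

lemma differentiableAt_stretchTrace {K r : ℝ} (hK : 0 < K) (hr : r ∈ Set.Ioo 0 R) :
    DifferentiableAt ℝ (fun t => stretchTrace (normDensity K ρ t) (meanDensity K ρ t)) r := by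
  have hv := (hB.hasDerivAt_tangentialStretch hK hr).differentiableAt
  have hρ : DifferentiableAt ℝ ρ r := (hB.contDiffOn_density.contDiffAt
    (Ioc_mem_nhds hr.1 hr.2)).differentiableAt one_ne_zero
  have hv_pos := tangentialStretch_pos (hB.meanDensity_pos hK hr)
  have hδ_pos : 0 < ρ r / K := div_pos (hB.density_pos hr) hK
  exact (hv.const_mul 2).add ((differentiableAt_const 1).div ((hv.pow 2).mul (hρ.div_const K))
    (mul_pos (pow_pos hv_pos 2) hδ_pos).ne')

variable {lam mu K : ℝ} (hE : IsElastic K (johnRad lam mu) (johnTan lam mu) ρ prad ptan)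

include hE

lemma prad_eq_stretch (hK : 0 < K) {r : ℝ} (hr : r ∈ Set.Ioo 0 R) :
    prad r = johnRad lam mu
      (stretchDensity (tangentialStretch (meanDensity K ρ r))
        (stretchTrace (normDensity K ρ r) (meanDensity K ρ r)))
      (stretchMeanDensity (tangentialStretch (meanDensity K ρ r))) := by
  have hη := hB.meanDensity_pos hK hr
  rw [stretchDensity_stretchTrace hη, stretchMeanDensity_tangentialStretch hη]
  exact hE.prad_eq r hr.1 (hB.density_pos hr)

lemma ptan_eq_stretch (hK : 0 < K) {r : ℝ} (hr : r ∈ Set.Ioo 0 R) :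
    ptan r = johnTan lam mu
      (stretchDensity (tangentialStretch (meanDensity K ρ r))
        (stretchTrace (normDensity K ρ r) (meanDensity K ρ r)))
      (stretchMeanDensity (tangentialStretch (meanDensity K ρ r))) := by
  have hη := hB.meanDensity_pos hK hr
  rw [stretchDensity_stretchTrace hη, stretchMeanDensity_tangentialStretch hη]
  exact hE.ptan_eq r hr.1 (hB.density_pos hr)

lemma deriv_stretchTrace (hK : 0 < K) {r : ℝ} (hr : r ∈ Set.Ioo 0 R) :
    (lam + 2 * mu) * deriv (fun t => stretchTrace (normDensity K ρ t) (meanDensity K ρ t)) r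
        / tangentialStretch (meanDensity K ρ r) ^ 2
      = ρ r * (mass ρ r / r ^ 2) := by
  obtain ⟨Φ, hΦ⟩ := hB.equilibrium
  obtain ⟨Φ', prad'⟩ := hΦ r hr
  have hη := hB.meanDensity_pos hK hr
  have hv := tangentialStretch_pos hη
  have stretch' := hasDerivAt_johnRad_stretch lam mu
    (v := fun t => tangentialStretch (meanDensity K ρ t))
    (Q := fun t => stretchTrace (normDensity K ρ t) (meanDensity K ρ t))
    (div_pos hr.1 hv) hv (div_mul_cancel₀ r hv.ne')
    (two_mul_tangentialStretch_lt_stretchTrace (div_pos (hB.density_pos hr) hK) hη)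
    (hB.hasDerivAt_tangentialStretch hK hr) (hB.differentiableAt_stretchTrace hK hr).hasDerivAt
  rw [← hB.prad_eq_stretch hE hK hr, ← hB.ptan_eq_stretch hE hK hr] at stretch'
  have same_function : prad =ᶠ[𝓝 r] _ :=
    Filter.eventuallyEq_of_mem (isOpen_Ioo.mem_nhds hr) fun t ht => hB.prad_eq_stretch hE hK ht
  have force_balance := prad'.unique (stretch'.congr_of_eventuallyEq same_function)
  rw [Φ'.deriv] at force_balance
  linarith

lemma hasDerivAt_stretchTrace (hlam : lam + 2 * mu ≠ 0) (hK : 0 < K) {r : ℝ}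
    (hr : r ∈ Set.Ioo 0 R) :
    HasDerivAt (fun t => stretchTrace (normDensity K ρ t) (meanDensity K ρ t))
      (4 * Real.pi * K ^ 2 / (3 * (lam + 2 * mu)) * (r / tangentialStretch (meanDensity K ρ r))
        / (tangentialStretch (meanDensity K ρ r) ^ 2
          * (stretchTrace (normDensity K ρ r) (meanDensity K ρ r)
            - 2 * tangentialStretch (meanDensity K ρ r)))) r := by
  refine (hB.differentiableAt_stretchTrace hK hr).hasDerivAt.congr_deriv ?_
  have : 0 < normDensity K ρ r := div_pos (hB.density_pos hr) hK
  have hη := hB.meanDensity_pos hK hr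
  have hv := tangentialStretch_pos hη
  have hr0 := hr.1
  have force := hB.deriv_stretchTrace hE hK hr
  rw [(normDensity_eq_iff (ρ := ρ) hK.ne').1 rfl,
    (meanDensity_eq_iff hK.ne' hr0.ne').1 rfl] at force
  have mean_density : meanDensity K ρ r = 1 / tangentialStretch (meanDensity K ρ r) ^ 3 :=
    (stretchMeanDensity_tangentialStretch hη).symm
  have radial_stretch : stretchTrace (normDensity K ρ r) (meanDensity K ρ r)
      - 2 * tangentialStretch (meanDensity K ρ r)
      = 1 / (tangentialStretch (meanDensity K ρ r) ^ 2 * normDensity K ρ r) :=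
    add_sub_cancel_left _ _
  rw [radial_stretch]
  generalize deriv (fun t => stretchTrace (normDensity K ρ t) (meanDensity K ρ t)) r = Q',
    tangentialStretch (meanDensity K ρ r) = v at *
  rw [mean_density] at force
  field_simp at force ⊢
  linarith

theorem isEulerianProfile {C α : ℝ} (hlam : lam + 2 * mu ≠ 0) (hK : 0 < K) (hα : 0 < α)
    (hC : C = 4 * Real.pi * K ^ 2 / (3 * (lam + 2 * mu))) (hρ0 : ρ 0 = K / α ^ 3) :
    IsEulerianProfile C α R (fun r => tangentialStretch (meanDensity K ρ r))
      (fun r => stretchTrace (normDensity K ρ r) (meanDensity K ρ r)) := by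
  have hδ {r : ℝ} (hr : r ∈ Set.Ioo 0 R) : 0 < normDensity K ρ r := div_pos (hB.density_pos hr) hK
  have hη {r : ℝ} (hr : r ∈ Set.Ioo 0 R) := hB.meanDensity_pos hK hr
  have hδ0 : normDensity K ρ 0 = stretchMeanDensity α :=
    (normDensity_eq_iff hK.ne').2 (hρ0.trans (div_eq_mul_one_div K _))
  have hη_lim := tendsto_meanDensity hB.continuousOn_density K hB.radius_pos
  have hδ_lim := hB.tendsto_normDensity K
  rw [hδ0] at hη_lim hδ_lim
  have hv_lim : Filter.Tendsto (fun r => tangentialStretch (meanDensity K ρ r)) (𝓝[>] 0) (𝓝 α) := by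
    have x_lim := hη_lim.rpow_const (p := 1 / 3) (Or.inl (stretchMeanDensity_pos hα).ne')
    rw [stretchMeanDensity_rpow_third hα] at x_lim
    have inv_lim := (tendsto_const_nhds (x := (1 : ℝ))).div x_lim (by positivity)
    rwa [one_div_one_div] at inv_lim
  refine ⟨?_, fun r hr => two_mul_tangentialStretch_lt_stretchTrace (hδ hr) (hη hr),
    fun r hr => hB.hasDerivAt_tangentialStretch hK hr,
    fun r hr => hC ▸ hB.hasDerivAt_stretchTrace hE hlam hK hr, hv_lim, ?_⟩
  · obtain ⟨B, hB_le⟩ := exists_meanDensity_le hB.continuousOn_density K hB.radius_pos.le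
    refine ⟨tangentialStretch (max B 1), tangentialStretch_pos (by positivity), fun r hr => ?_⟩
    have := hη hr
    have := (hB_le r ⟨hr.1, hr.2.le⟩).trans (le_max_left B 1)
    unfold tangentialStretch
    gcongr
  · have Q_lim := (hv_lim.const_mul 2).add ((tendsto_const_nhds (x := (1 : ℝ))).div
      ((hv_lim.pow 2).mul hδ_lim) (mul_pos (pow_pos hα 2) (stretchMeanDensity_pos hα)).ne')
    have trace_eq := stretchTrace_stretchMeanDensity hα
    rw [stretchTrace, tangentialStretch_stretchMeanDensity hα] at trace_eq
    rwa [trace_eq] at Q_lim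

end IsRegularBall

/-! ### Uniqueness -/

lemma eq_of_first_zeros {f : ℝ → ℝ} {a b : ℝ} (ha : 0 ≤ a) (hb : 0 ≤ b)
    (hfa : f a = 0) (hfb : f b = 0) (hpos_a : ∀ x ∈ Set.Ico 0 a, 0 < f x)
    (hpos_b : ∀ x ∈ Set.Ico 0 b, 0 < f x) : a = b := by
  rcases lt_trichotomy a b with hab | hab | hab
  · exact absurd hfa (hpos_b a ⟨ha, hab⟩).ne'
  · exact hab
  · exact absurd hfb (hpos_a b ⟨hb, hab⟩).ne'

namespace IsLagrangianProfile

variable {C α lam mu K : ℝ} {u q : ℝ → ℝ} (h : IsLagrangianProfile C α u q)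
  {R : ℝ} {ρ prad ptan : ℝ → ℝ} (hB : IsRegularBall R ρ prad ptan)
  (hE : IsElastic K (johnRad lam mu) (johnTan lam mu) ρ prad ptan)

include h hB hE

lemma eqOn_ballField_of_isRegularBall (hlam : lam + 2 * mu ≠ 0) (hK : 0 < K)
    (hC : C = 4 * Real.pi * K ^ 2 / (3 * (lam + 2 * mu))) (hρ0 : ρ 0 = K / α ^ 3) :
    Set.EqOn ρ (ballField (densityLaw K) u q R) (Set.Ici 0) ∧
      Set.EqOn prad (ballField (johnRad lam mu) u q R) (Set.Ici 0) ∧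
      Set.EqOn ptan (ballField (johnTan lam mu) u q R) (Set.Ici 0) := by
  have stretch_eq {r : ℝ} (hr : r ∈ Set.Ioo 0 R) :=
    h.eq_of_isEulerianProfile (hB.isEulerianProfile hE hlam hK h.α_pos hC hρ0) hr
  have field_continuous {F : ℝ → ℝ → ℝ}
      (hF : ContDiffOn ℝ 1 (fun x : ℝ × ℝ => F x.1 x.2) (Set.Ioi 0 ×ˢ Set.Ioi 0)) :
      Continuous (spatialField F u q) :=
    (h.contDiff_spatialField hF).continuous
  refine ⟨hB.eqOn_ballField hB.continuousOn_density
      (field_continuous (contDiffOn_densityLaw K)) (fun r hr => ?_)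
      fun r hr => (hB.vacuum r hr).1,
    hB.eqOn_ballField hB.continuousOn_prad
      (field_continuous (contDiffOn_johnRad lam mu)) (fun r hr => ?_)
      fun r hr => (hB.vacuum r hr).2.1,
    hB.eqOn_ballField hB.continuousOn_ptan
      (field_continuous (contDiffOn_johnTan lam mu)) (fun r hr => ?_)
      fun r hr => (hB.vacuum r hr).2.2⟩ <;>
    rw [spatialField, materialField, (stretch_eq hr).1, (stretch_eq hr).2]
  · rw [stretchDensity_stretchTrace (hB.meanDensity_pos hK hr)]
    exact (normDensity_eq_iff hK.ne').1 rfl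
  · exact hB.prad_eq_stretch hE hK hr
  · exact hB.ptan_eq_stretch hE hK hr

theorem eq_of_isRegularBall (hlam : lam + 2 * mu ≠ 0) (hK : 0 < K)
    (hC : C = 4 * Real.pi * K ^ 2 / (3 * (lam + 2 * mu))) (hρ0 : ρ 0 = K / α ^ 3)
    {R₀ : ℝ} (hR₀ : 0 ≤ R₀) (hzero : spatialField (johnRad lam mu) u q R₀ = 0)
    (hpos : ∀ r ∈ Set.Ico 0 R₀, 0 < spatialField (johnRad lam mu) u q r) :
    R = R₀ ∧ Set.EqOn ρ (ballField (densityLaw K) u q R₀) (Set.Ici 0) ∧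
      Set.EqOn prad (ballField (johnRad lam mu) u q R₀) (Set.Ici 0) ∧
      Set.EqOn ptan (ballField (johnTan lam mu) u q R₀) (Set.Ici 0) := by
  have fields_eq := h.eqOn_ballField_of_isRegularBall hB hE hlam hK hC hρ0
  have prad_eq {r : ℝ} (hr : r ∈ Set.Icc 0 R) : prad r = spatialField (johnRad lam mu) u q r :=
    (fields_eq.2.1 hr.1).trans (ballField_of_le _ _ _ hr.2)
  have hR := hB.radius_pos.le
  obtain rfl : R = R₀ := eq_of_first_zeros hR hR₀
    ((prad_eq (Set.right_mem_Icc.2 hR)).symm.trans hB.prad_boundary) hzero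
    (fun r hr => prad_eq (Set.Ico_subset_Icc_self hr) ▸ hB.prad_pos r hr) hpos
  exact ⟨rfl, fields_eq⟩

end IsLagrangianProfile

lemma exists_div_cube_eq {K ρc : ℝ} (hK : K ≠ 0) (hc : 1 < ρc / K) :
    ∃ α, 0 < α ∧ α < 1 ∧ ρc = K / α ^ 3 := by
  have hδ := one_pos.trans hc
  refine ⟨tangentialStretch (ρc / K), tangentialStretch_pos hδ,
    (div_lt_one (Real.rpow_pos_of_pos hδ _)).2 (Real.one_lt_rpow hc (by norm_num)), ?_⟩
  rw [div_eq_mul_one_div, ← stretchMeanDensity, stretchMeanDensity_tangentialStretch hδ,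
    mul_div_cancel₀ _ hK]

end ElasticBall

theorem theorem5_general (lam mu : ℝ) (hmu : 0 ≤ mu) (K ρc : ℝ) (hK : 0 < K) (hc : 1 < ρc / K)
    (hcenter : 0 < ElasticBall.johnRad lam mu (ρc / K) (ρc / K)) :
    ∃ (R : ℝ) (ρ prad ptan : ℝ → ℝ),
      (ElasticBall.IsStronglyRegularBall R ρ prad ptan ∧
        ElasticBall.IsElastic K (ElasticBall.johnRad lam mu) (ElasticBall.johnTan lam mu)
          ρ prad ptan ∧
        ρ 0 = ρc) ∧
      (∀ (R' : ℝ) (ρ' prad' ptan' : ℝ → ℝ),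
        ElasticBall.IsRegularBall R' ρ' prad' ptan' →
        ElasticBall.IsElastic K (ElasticBall.johnRad lam mu) (ElasticBall.johnTan lam mu)
          ρ' prad' ptan' →
        ρ' 0 = ρc →
        R' = R ∧ Set.EqOn ρ' ρ (Set.Ici 0) ∧ Set.EqOn prad' prad (Set.Ici 0) ∧
          Set.EqOn ptan' ptan (Set.Ici 0)) ∧
      0 < deriv (fun d => ElasticBall.johnRad lam mu d (ρc / K)) (ρc / K) ∧
      ∀ r ∈ Set.Ioc 0 R,
        0 < ρ r ∧
        0 < deriv (fun d => ElasticBall.johnRad lam mu d (ElasticBall.meanDensity K ρ r))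
          (ElasticBall.normDensity K ρ r) ∧
        ρ r < ρc ∧
        4 * Real.pi / 3 * max (ρ r) K * r ^ 3 < ElasticBall.mass ρ r ∧
        ElasticBall.mass ρ r < 4 * Real.pi / 3 * ρc * r ^ 3 := by
  have hlam := ElasticBall.pos_of_johnRad_diag_pos hmu hc hcenter
  obtain ⟨α, hα, hα1, rfl⟩ := ElasticBall.exists_div_cube_eq hK.ne' hc
  have hδc : K / α ^ 3 / K = 1 / α ^ 3 := by field_simp
  rw [hδc] at hcenter hc ⊢
  obtain ⟨u, q, h⟩ := ElasticBall.exists_isLagrangianProfile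
    (C := 4 * Real.pi * K ^ 2 / (3 * (lam + 2 * mu))) (by positivity) hα
  obtain ⟨R, hR, hu, hzero, hpos⟩ := h.exists_surface hα1 hlam hcenter
  refine ⟨R, ElasticBall.ballField (ElasticBall.densityLaw K) u q R,
    ElasticBall.ballField (ElasticBall.johnRad lam mu) u q R,
    ElasticBall.ballField (ElasticBall.johnTan lam mu) u q R,
    ⟨h.isStronglyRegularBall hmu hlam.ne' hK rfl hR hpos hzero, h.isElastic hK lam mu R, ?_⟩,
    fun R' ρ' prad' ptan' hB hE hρ0 =>
      h.eq_of_isRegularBall hB hE hlam.ne' hK rfl hρ0 hR.le hzero hpos,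
    ElasticBall.deriv_johnRad_pos hlam (one_pos.trans hc) (one_pos.trans hc), fun r hr => ?_⟩
  · rw [ElasticBall.ballField_of_le _ _ _ hR.le, h.spatialField_zero, ElasticBall.densityLaw,
      mul_one_div]
  · refine ⟨?_, ?_, h.density_bounds hK hr.1 hr.2 hu⟩
    · rw [ElasticBall.ballField_of_le _ _ _ hr.2]
      exact h.spatialField_densityLaw_pos hK r
    · rw [ElasticBall.normDensity_ballField u q hK.ne' hr.2,
        h.meanDensity_ballField hK.ne' hr.1 hr.2]
      exact ElasticBall.deriv_johnRad_pos hlam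
        (ElasticBall.stretchDensity_pos (h.u_pos _) (h.two_mul_u_lt_q _))
        (ElasticBall.stretchMeanDensity_pos (h.u_pos _))

theorem theorem5 (lam mu : ℝ) (hmu : 0 ≤ mu) (hbulk : 0 < 3 * lam + 2 * mu)
    (K ρc : ℝ) (hK : 0 < K) (hc : 1 < ρc / K) :
    ∃ (R : ℝ) (ρ prad ptan : ℝ → ℝ),
      (ElasticBall.IsStronglyRegularBall R ρ prad ptan ∧
        ElasticBall.IsElastic K (ElasticBall.johnRad lam mu) (ElasticBall.johnTan lam mu)
          ρ prad ptan ∧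
        ρ 0 = ρc) ∧
      (∀ (R' : ℝ) (ρ' prad' ptan' : ℝ → ℝ),
        ElasticBall.IsRegularBall R' ρ' prad' ptan' →
        ElasticBall.IsElastic K (ElasticBall.johnRad lam mu) (ElasticBall.johnTan lam mu)
          ρ' prad' ptan' →
        ρ' 0 = ρc →
        R' = R ∧ Set.EqOn ρ' ρ (Set.Ici 0) ∧ Set.EqOn prad' prad (Set.Ici 0) ∧
          Set.EqOn ptan' ptan (Set.Ici 0)) ∧
      0 < deriv (fun d => ElasticBall.johnRad lam mu d (ρc / K)) (ρc / K) ∧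
      ∀ r ∈ Set.Ioc 0 R,
        0 < ρ r ∧
        0 < deriv (fun d => ElasticBall.johnRad lam mu d (ElasticBall.meanDensity K ρ r))
          (ElasticBall.normDensity K ρ r) ∧
        ρ r < ρc ∧
        4 * Real.pi / 3 * max (ρ r) K * r ^ 3 < ElasticBall.mass ρ r ∧
        ElasticBall.mass ρ r < 4 * Real.pi / 3 * ρc * r ^ 3 :=
  theorem5_general lam mu hmu K ρc hK hc (ElasticBall.johnRad_diag_pos hmu hbulk hc)
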